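/- Let $N\ge 1$, let $L=L(x,v,t)\in C^2(\mathbb R^N\times\mathbb R^N\times\mathbb R)$ be a Lagrangian whose Legendre map $(x,v,t)\mapsto(x,L_v(x,v,t),t)$ is a $C^1$-diffeomorphism of $\mathbb R^N\times\mathbb R^N\times\mathbb R$ onto itself, and let $H(x,p,t)=p\cdot v-L(x,v,t)$ with $p=L_v(x,v,t)$ be the corresponding Hamilton function. Let $S_0\in C^1(\mathbb R^N)$ and $T>0$. Suppose that for every $x_0\in\mathbb R^N$ the Cauchy problem $$\dot x=H_p(x,p,t),\qquad \dot p=-H_x(x,p,t),\qquad x|_{t=0}=x_0,\qquad p|_{t=0}=\nabla S_0(x_0)$$ has a solution $(x(t,x_0),p(t,x_0))$ for $t\in[0,T]$, and that for every $t\in[0,T]$ the map $x_0\mapsto x(t,x_0)$ is a $C^1$-diffeomorphism of $\mathbb R^N$ onto itself, with inverse $x\mapsto x_0(t,x)$. Put $$\mathcal S(t,x_0)=S_0(x_0)+\int_0^t L\big(x(s,x_0),\dot x(s,x_0),s\big)\,ds,\qquad S(t,x)=\mathcal S(t,x_0(t,x)).$$ Then $S\in C^1([0,T]\times\mathbb R^N)$,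 $S$ solves the Cauchy problem $$-\partial_t S(t,x)=H(x,\nabla S(t,x),t)\quad\text{for }(t,x)\in[0,T]\times\mathbb R^N,\qquad S(0,x)=S_0(x)\quad\text{for }x\in\mathbb R^N$$ (with one-sided time derivatives at $t=0$ and $t=T$), and it is the only solution of this problem in $C^1([0,T]\times\mathbb R^N)$. -/

import Mathlib

open Set
open scoped Manifold

noncomputable section

namespace HamiltonJacobi

/-- The configuration space `ℝ^N`, identified with its dual by the inner product. -/
abbrev Conf (N : ℕ) : Type := EuclideanSpace ℝ (Fin N)

/-- The extended phase space `ℝ^N × ℝ^N × ℝ`. -/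
abbrev ExtPhase (N : ℕ) : Type := Conf N × Conf N × ℝ

/-- `f` is a `C¹`-diffeomorphism of the normed space `E` onto the normed space `F`. -/
def IsC1Diffeo {E F : Type*} [NormedAddCommGroup E] [NormedSpace ℝ E]
    [NormedAddCommGroup F] [NormedSpace ℝ F] (f : E → F) : Prop :=
  ∃ Φ : Diffeomorph 𝓘(ℝ, E) 𝓘(ℝ, F) E F 1, ∀ z, Φ z = f z

variable {N : ℕ}

/-- The Legendre map `(x, v, t) ↦ (x, L_v(x, v, t), t)`. -/
def legendreMap (L : ExtPhase N → ℝ) (z : ExtPhase N) : ExtPhase N :=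
  (z.1, gradient (fun v => L (z.1, v, z.2.2)) z.2.1, z.2.2)

/-- The Hamilton function `H(x, p, t) = p · v - L(x, v, t)`, where `(x, v, t)` is the preimage
of `(x, p, t)` under the Legendre map (used only when that map is a bijection). -/
def hamiltonian (L : ExtPhase N → ℝ) (z : ExtPhase N) : ℝ :=
  inner ℝ z.2.1 (Function.invFun (legendreMap L) z).2.1 - L (Function.invFun (legendreMap L) z)

/-- `t ↦ (x t x₀, p t x₀)`, for every `x₀`, solves on `[0, T]` the Hamilton system
`x' = H_p`, `p' = -H_x` with initial data `x = x₀`, `p = ∇S₀(x₀)` at `t = 0`. -/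
structure IsHamiltonFlow (H : ExtPhase N → ℝ) (S₀ : Conf N → ℝ) (T : ℝ)
    (x p : ℝ → Conf N → Conf N) : Prop where
  position : ∀ x₀, ∀ t ∈ Icc 0 T,
    HasDerivWithinAt (fun s => x s x₀)
      (gradient (fun q => H (x t x₀, q, t)) (p t x₀)) (Icc 0 T) t
  momentum : ∀ x₀, ∀ t ∈ Icc 0 T,
    HasDerivWithinAt (fun s => p s x₀)
      (-gradient (fun y => H (y, p t x₀, t)) (x t x₀)) (Icc 0 T) t
  position_zero : ∀ x₀, x 0 x₀ = x₀
  momentum_zero : ∀ x₀, p 0 x₀ = gradient S₀ x₀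

/-- The action integral `S₀(x₀) + ∫₀ᵗ L(x(s,x₀), ẋ(s,x₀), s) ds` along the ray from `x₀`. -/
def rayAction (L : ExtPhase N → ℝ) (S₀ : Conf N → ℝ) (T : ℝ)
    (x : ℝ → Conf N → Conf N) (t : ℝ) (x₀ : Conf N) : ℝ :=
  S₀ x₀ + ∫ s in (0 : ℝ)..t, L (x s x₀, derivWithin (fun r => x r x₀) (Icc 0 T) s, s)

/-- The action as a function of time and the end point `y` of the ray: `x₀ = x₀(t, y)` is the
point with `x(t, x₀) = y` (used only when `x₀ ↦ x(t, x₀)` is a bijection). -/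
def action (L : ExtPhase N → ℝ) (S₀ : Conf N → ℝ) (T : ℝ)
    (x : ℝ → Conf N → Conf N) (t : ℝ) (y : Conf N) : ℝ :=
  rayAction L S₀ T x t (Function.invFun (x t) y)

/-- `S` is a classical (`C¹` up to the boundary times) solution on `[0, T] × ℝ^N` of
`-∂S/∂t = H(x, ∇S, t)`, `S|_{t=0} = S₀`; time derivatives at `0` and `T` are one-sided. -/
structure IsHJSolution (H : ExtPhase N → ℝ) (S₀ : Conf N → ℝ) (T : ℝ)
    (S : ℝ → Conf N → ℝ) : Prop where
  contDiffOn : ContDiffOn ℝ 1 (fun q : ℝ × Conf N => S q.1 q.2) (Icc 0 T ×ˢ univ)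
  equation : ∀ t ∈ Icc 0 T, ∀ y,
    -derivWithin (fun s => S s y) (Icc 0 T) t = H (y, gradient (S t) y, t)
  initial : ∀ y, S 0 y = S₀ y

end HamiltonJacobi

end

/-! Existence rests on the first variation of the action: its gradient at the end of a ray should be
the momentum there. Compare two neighbouring rays and let `G s` be the difference of their actions
minus `⟨p, difference of positions⟩`. Since `p = L_v` and `p' = L_x` along a ray, the derivative of
`G` is a Taylor remainder of `L`, quadratic in the phase space distance of the rays; at time 0, `p =
∇S₀` makes `G` of first-order smallness. This gives the gradient (`isLittleO_rayAction`), and a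
first order expansion along the ray adds the time derivative `L - p · v = -H`
(`hasFDerivWithinAt_action`).

The difficulty is that `S₀` is only C¹, so nothing says beforehand that momenta are Lipschitz in the
initial point, while the remainder must be small compared with the distance of positions alone. The
diffeomorphism hypothesis at two different times supplies this (`exists_phase_le_position`). The
position increment at a nearby time `t₁` is the one at `t₀` plus `(t₁ - t₀)` times the velocity
increment, up to a small multiple of the phase increment. Position increments at both times are
comparable, so they bound the velocity increment, and through the Legendre map the momentum
increment.

Uniqueness is a domain of dependence argument made local, as `H` has no global bound on its speed of
propagation. In ray coordinates `(t, b)`, take a point minimising `t + ‖b - a₁‖` on the closure of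
the set where two solutions disagree. Strictly below this level they agree, so their gradients
coincide at the minimiser, by continuity along its ray (`gradient_eq_of_cone`). Nearby, the
difference of the solutions is therefore transported with velocity arbitrarily close to that of the
ray (`exists_transport_le`). Thin backward cones around the ray direction have their bases below the
level or at time 0, so the difference vanishes near the minimiser (`cone_eq_zero`,
`eventually_eq_of_cone`), which contradicts its choice. -/

namespace HamiltonJacobi

open Metric Filter Topology Asymptotics

/-! ### Stability of trajectories of a locally Lipschitz field -/

section Trajectories

variable {E : Type*} [NormedAddCommGroup E] [NormedSpace ℝ E]

/-- A Grönwall estimate in which only `u` is known beforehand to stay in a ball. The barrier grows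
at rate `K + 1`, strictly faster than the field separates trajectories, and never exceeds 1.
Whenever the distance equals the barrier, `v` is still in the larger ball, so the Lipschitz bound
applies and prevents crossing. -/
theorem norm_sub_le_of_initial_lt {f : ℝ → E → E} {u v : ℝ → E} {a b R ε : ℝ} {K : NNReal}
    (hf : ∀ t ∈ Icc a b, LipschitzOnWith K (f t) (closedBall 0 (R + 1)))
    (hu : ∀ t ∈ Icc a b, HasDerivWithinAt u (f t (u t)) (Icc a b) t)
    (hv : ∀ t ∈ Icc a b, HasDerivWithinAt v (f t (v t)) (Icc a b) t)
    (hR : ∀ t ∈ Icc a b, ‖u t‖ ≤ R) (hε : 0 < ε) (h₀ : ‖v a - u a‖ ≤ ε)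
    (h₁ : ε * Real.exp ((K + 1) * (b - a)) ≤ 1) :
    ∀ t ∈ Icc a b, ‖v t - u t‖ ≤ ε * Real.exp ((K + 1) * (b - a)) := by
  have hle : ∀ t ∈ Icc a b, Real.exp ((K + 1) * (t - a)) ≤ Real.exp ((K + 1) * (b - a)) := by
    intro t ht
    have hK : (0 : ℝ) ≤ K + 1 := by positivity
    exact Real.exp_le_exp.2 (mul_le_mul_of_nonneg_left (by linarith [ht.2]) hK)
  have hd : ∀ t ∈ Icc a b,
      HasDerivWithinAt (fun s => v s - u s) (f t (v t) - f t (u t)) (Icc a b) t :=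
    fun t ht => (hv t ht).sub (hu t ht)
  have key := image_norm_le_of_norm_deriv_right_lt_deriv_boundary (a := a) (b := b)
    (f := fun s => v s - u s) (f' := fun t => f t (v t) - f t (u t))
    (B := fun t => ε * Real.exp ((K + 1) * (t - a)))
    (B' := fun t => ε * (Real.exp ((K + 1) * (t - a)) * (K + 1)))
    (fun t ht => (hd t ht).continuousWithinAt)
    (fun t ht => (hd t (Ico_subset_Icc_self ht)).mono_of_mem_nhdsWithin
      (Icc_mem_nhdsGE_of_mem ht))
    (by simpa using h₀)
    (fun t => by
      have h := ((((hasDerivAt_id t).sub_const a).const_mul ((K : ℝ) + 1)).exp).const_mul ε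
      simpa using h)
    (by
      intro t ht heq
      have htI := Ico_subset_Icc_self ht
      have hpos : 0 < ε * Real.exp ((K + 1) * (t - a)) := by positivity
      have h1 : ‖v t - u t‖ ≤ 1 := by
        rw [heq]
        exact (mul_le_mul_of_nonneg_left (hle t htI) hε.le).trans h₁
      have hum : u t ∈ closedBall (0 : E) (R + 1) := by
        rw [mem_closedBall_zero_iff]; linarith [hR t htI]
      have hvm : v t ∈ closedBall (0 : E) (R + 1) := by
        rw [mem_closedBall_zero_iff]
        calc ‖v t‖ = ‖u t + (v t - u t)‖ := by congr 1; abel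
          _ ≤ ‖u t‖ + ‖v t - u t‖ := norm_add_le _ _
          _ ≤ R + 1 := by linarith [hR t htI]
      have := (hf t htI).norm_sub_le hvm hum
      rw [heq] at this
      calc ‖f t (v t) - f t (u t)‖ ≤ K * (ε * Real.exp ((K + 1) * (t - a))) := this
        _ < ε * (Real.exp ((K + 1) * (t - a)) * (K + 1)) := by linarith)
  intro t ht
  exact (key ht).trans (mul_le_mul_of_nonneg_left (hle t ht) hε.le)

theorem norm_sub_le_of_trajectories_right {f : ℝ → E → E} {u v : ℝ → E} {a b R : ℝ} {K : NNReal}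
    (hf : ∀ t ∈ Icc a b, LipschitzOnWith K (f t) (closedBall 0 (R + 1)))
    (hu : ∀ t ∈ Icc a b, HasDerivWithinAt u (f t (u t)) (Icc a b) t)
    (hv : ∀ t ∈ Icc a b, HasDerivWithinAt v (f t (v t)) (Icc a b) t)
    (hR : ∀ t ∈ Icc a b, ‖u t‖ ≤ R)
    (h₁ : ‖v a - u a‖ * Real.exp ((K + 1) * (b - a)) ≤ 1) :
    ∀ t ∈ Icc a b, ‖v t - u t‖ ≤ ‖v a - u a‖ * Real.exp ((K + 1) * (b - a)) := by
  intro t ht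
  rcases (norm_nonneg (v a - u a)).eq_or_lt with h0 | h0
  · rw [← h0, zero_mul]
    -- For equal initial points the barrier would be zero and the strict inequality would fail;
    -- arbitrarily small positive barriers are used instead.
    refine le_of_forall_pos_le_add fun η hη => ?_
    have hexp := Real.exp_pos ((K + 1) * (b - a))
    have h := norm_sub_le_of_initial_lt hf hu hv hR
      (ε := min η 1 / Real.exp ((K + 1) * (b - a))) (by positivity) (by rw [← h0]; positivity)
      (by rw [div_mul_cancel₀ _ hexp.ne']; exact min_le_right _ _) t ht
    rw [div_mul_cancel₀ _ hexp.ne'] at h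
    linarith [min_le_left η 1]
  · exact norm_sub_le_of_initial_lt hf hu hv hR h0 le_rfl h₁ t ht

/-- The reflection `t ↦ a + b - t` replaces the field by its negative, which has the same Lipschitz
constant. -/
theorem norm_sub_le_of_trajectories_left {f : ℝ → E → E} {u v : ℝ → E} {a b R : ℝ} {K : NNReal}
    (hf : ∀ t ∈ Icc a b, LipschitzOnWith K (f t) (closedBall 0 (R + 1)))
    (hu : ∀ t ∈ Icc a b, HasDerivWithinAt u (f t (u t)) (Icc a b) t)
    (hv : ∀ t ∈ Icc a b, HasDerivWithinAt v (f t (v t)) (Icc a b) t)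
    (hR : ∀ t ∈ Icc a b, ‖u t‖ ≤ R)
    (h₁ : ‖v b - u b‖ * Real.exp ((K + 1) * (b - a)) ≤ 1) :
    ∀ t ∈ Icc a b, ‖v t - u t‖ ≤ ‖v b - u b‖ * Real.exp ((K + 1) * (b - a)) := by
  have hmem : ∀ t ∈ Icc a b, a + b - t ∈ Icc a b := fun t ht =>
    ⟨by linarith [ht.2], by linarith [ht.1]⟩
  have hrev : ∀ w : ℝ → E, (∀ t ∈ Icc a b, HasDerivWithinAt w (f t (w t)) (Icc a b) t) →
      ∀ t ∈ Icc a b, HasDerivWithinAt (fun s => w (a + b - s))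
        ((fun s y => -f (a + b - s) y) t ((fun s => w (a + b - s)) t)) (Icc a b) t := by
    intro w hw t ht
    have h := (hw _ (hmem t ht)).scomp t
      (((hasDerivAt_id t).const_sub (a + b)).hasDerivWithinAt (s := Icc a b)) hmem
    simpa [Function.comp_def] using h
  intro t ht
  have := norm_sub_le_of_trajectories_right (f := fun s y => -f (a + b - s) y)
    (u := fun s => u (a + b - s)) (v := fun s => v (a + b - s)) (a := a) (b := b) (R := R) (K := K)
    (fun t ht => (hf _ (hmem t ht)).neg) (hrev u hu) (hrev v hv) (fun t ht => hR _ (hmem t ht))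
    (by simpa using h₁) (a + b - t) (hmem t ht)
  simpa using this

theorem norm_sub_le_of_trajectories {f : ℝ → E → E} {u v : ℝ → E} {T R : ℝ} {K : NNReal}
    (hf : ∀ t ∈ Icc 0 T, LipschitzOnWith K (f t) (closedBall 0 (R + 1)))
    (hu : ∀ t ∈ Icc 0 T, HasDerivWithinAt u (f t (u t)) (Icc 0 T) t)
    (hv : ∀ t ∈ Icc 0 T, HasDerivWithinAt v (f t (v t)) (Icc 0 T) t)
    (hR : ∀ t ∈ Icc 0 T, ‖u t‖ ≤ R) {t₀ : ℝ} (ht₀ : t₀ ∈ Icc 0 T)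
    (h₁ : ‖v t₀ - u t₀‖ * Real.exp ((K + 1) * T) ≤ 1) :
    ∀ t ∈ Icc 0 T, ‖v t - u t‖ ≤ ‖v t₀ - u t₀‖ * Real.exp ((K + 1) * T) := by
  intro t ht
  have hexp : ∀ s ≤ T, Real.exp ((K + 1) * s) ≤ Real.exp ((K + 1) * T) := fun s hs =>
    Real.exp_le_exp.2 (mul_le_mul_of_nonneg_left hs (by positivity))
  have hn := norm_nonneg (v t₀ - u t₀)
  rcases le_total t₀ t with h | h
  · have hsub : Icc t₀ t ⊆ Icc 0 T := Icc_subset_Icc ht₀.1 ht.2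
    have he := hexp (t - t₀) (by linarith [ht₀.1, ht.2])
    exact (norm_sub_le_of_trajectories_right (fun s hs => hf s (hsub hs))
      (fun s hs => (hu s (hsub hs)).mono hsub) (fun s hs => (hv s (hsub hs)).mono hsub)
      (fun s hs => hR s (hsub hs)) ((mul_le_mul_of_nonneg_left he hn).trans h₁) t
      (right_mem_Icc.2 h)).trans (mul_le_mul_of_nonneg_left he hn)
  · have hsub : Icc t t₀ ⊆ Icc 0 T := Icc_subset_Icc ht.1 ht₀.2
    have he := hexp (t₀ - t) (by linarith [ht.1, ht₀.2])
    exact (norm_sub_le_of_trajectories_left (fun s hs => hf s (hsub hs))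
      (fun s hs => (hu s (hsub hs)).mono hsub) (fun s hs => (hv s (hsub hs)).mono hsub)
      (fun s hs => hR s (hsub hs)) ((mul_le_mul_of_nonneg_left he hn).trans h₁) t
      (left_mem_Icc.2 h)).trans (mul_le_mul_of_nonneg_left he hn)

variable {A : Type*} [PseudoMetricSpace A]

/-- A family of trajectories whose initial points depend continuously on a parameter is locally
bounded and locally uniformly stable, uniformly in time. -/
theorem exists_stable_nhd {f : ℝ → E → E} {z : ℝ → A → E} {T : ℝ} (hT : 0 ≤ T)
    (hf : ∀ R : ℝ, ∃ K : NNReal, ∀ t ∈ Icc 0 T, LipschitzOnWith K (f t) (closedBall 0 R))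
    (hz : ∀ a, ∀ t ∈ Icc 0 T, HasDerivWithinAt (fun s => z s a) (f t (z t a)) (Icc 0 T) t)
    (hz₀ : Continuous (z 0)) (a : A) :
    ∃ M > 0, ∃ R, ∃ ε > 0, (∀ b ∈ ball a ε, ∀ t ∈ Icc 0 T, ‖z t b‖ ≤ R) ∧
      ∀ b ∈ ball a ε, ∀ c ∈ ball a ε, ∀ s ∈ Icc 0 T, ∀ t ∈ Icc 0 T,
        ‖z s b - z s c‖ ≤ M * ‖z t b - z t c‖ := by
  have hcont : ∀ b, ContinuousOn (fun s => z s b) (Icc 0 T) := fun b t ht =>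
    (hz b t ht).continuousWithinAt
  have h0 : (0 : ℝ) ∈ Icc 0 T := left_mem_Icc.2 hT
  obtain ⟨R, hR⟩ := isCompact_Icc.exists_bound_of_continuousOn (hcont a)
  obtain ⟨K, hK⟩ := hf (R + 1 + 1)
  set m := Real.exp ((K + 1) * T) with hm
  have hmpos : 0 < m := Real.exp_pos _
  have hm1 : 1 ≤ m := Real.one_le_exp (by positivity)
  -- One factor `m` is spent on carrying closeness from time 0 to time `t`. The other keeps any two
  -- trajectories within `1 / m` at every time, the smallness needed to restart the estimate from an
  -- arbitrary time.
  obtain ⟨ε, hε, hball⟩ := Metric.continuousAt_iff.1 (hz₀.continuousAt (x := a))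
    (1 / (2 * m * m)) (by positivity)
  have hclose : ∀ b ∈ ball a ε, ∀ t ∈ Icc 0 T, ‖z t b - z t a‖ ≤ 1 / (2 * m) := by
    intro b hb t ht
    have h1 : ‖z 0 b - z 0 a‖ ≤ 1 / (2 * m * m) := by
      rw [← dist_eq_norm]; exact (hball hb).le
    have h2 : ‖z 0 b - z 0 a‖ * m ≤ 1 / (2 * m) := by
      calc _ ≤ 1 / (2 * m * m) * m := mul_le_mul_of_nonneg_right h1 hmpos.le
        _ = 1 / (2 * m) := by field_simp
    refine (norm_sub_le_of_trajectories (R := R) (K := K) (fun t ht => (hK t ht).mono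
      (closedBall_subset_closedBall (by linarith))) (hz a) (hz b) hR h0 ?_ t ht).trans h2
    refine h2.trans ?_
    rw [div_le_one (by positivity)]; linarith
  have hle : 1 / (2 * m) ≤ 1 / 2 := by
    apply one_div_le_one_div_of_le <;> linarith
  have hbd : ∀ b ∈ ball a ε, ∀ t ∈ Icc 0 T, ‖z t b‖ ≤ R + 1 := by
    intro b hb t ht
    calc ‖z t b‖ = ‖z t a + (z t b - z t a)‖ := by congr 1; abel
      _ ≤ ‖z t a‖ + ‖z t b - z t a‖ := norm_add_le _ _
      _ ≤ R + 1 := by linarith [hR t ht, hclose b hb t ht]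
  refine ⟨m, hmpos, R + 1, ε, hε, hbd, fun b hb c hc s hs t ht => ?_⟩
  rw [mul_comm]
  refine norm_sub_le_of_trajectories hK (hz c) (hz b) (hbd c hc) ht ?_ s hs
  have h3 : ‖z t b - z t c‖ ≤ 1 / m := by
    calc ‖z t b - z t c‖ = ‖(z t b - z t a) - (z t c - z t a)‖ := by congr 1; abel
      _ ≤ ‖z t b - z t a‖ + ‖z t c - z t a‖ := norm_sub_le _ _
      _ ≤ 1 / (2 * m) + 1 / (2 * m) := add_le_add (hclose b hb t ht) (hclose c hc t ht)
      _ = 1 / m := by field_simp; norm_num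
  calc _ ≤ 1 / m * m := mul_le_mul_of_nonneg_right h3 hmpos.le
    _ = 1 := by field_simp

theorem continuousOn_of_trajectories {f : ℝ → E → E} {z : ℝ → A → E} {T : ℝ} (hT : 0 ≤ T)
    (hf : ∀ R : ℝ, ∃ K : NNReal, ∀ t ∈ Icc 0 T, LipschitzOnWith K (f t) (closedBall 0 R))
    (hz : ∀ a, ∀ t ∈ Icc 0 T, HasDerivWithinAt (fun s => z s a) (f t (z t a)) (Icc 0 T) t)
    (hz₀ : Continuous (z 0)) :
    ContinuousOn (fun q : ℝ × A => z q.1 q.2) (Icc 0 T ×ˢ univ) := by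
  rintro ⟨t, a⟩ ⟨ht, -⟩
  obtain ⟨M, hM, -, ε, hε, -, hst⟩ := exists_stable_nhd hT hf hz hz₀ a
  have h0 : (0 : ℝ) ∈ Icc 0 T := left_mem_Icc.2 hT
  have h1 : Tendsto (fun q : ℝ × A => z q.1 a) (𝓝[Icc 0 T ×ˢ univ] (t, a)) (𝓝 (z t a)) :=
    (hz a t ht).continuousWithinAt.tendsto.comp
      (tendsto_nhdsWithin_of_tendsto_nhds_of_eventually_within _
        (continuous_fst.continuousAt.mono_left nhdsWithin_le_nhds)
        (eventually_nhdsWithin_of_forall fun q hq => hq.1))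
  have h2 : Tendsto (fun q : ℝ × A => M * ‖z 0 q.2 - z 0 a‖) (𝓝[Icc 0 T ×ˢ univ] (t, a))
      (𝓝 0) := by
    have hc : Continuous fun q : ℝ × A => M * ‖z 0 q.2 - z 0 a‖ := by fun_prop
    have := (hc.continuousAt (x := (t, a))).tendsto.mono_left
      (nhdsWithin_le_nhds (s := Icc 0 T ×ˢ univ))
    simpa using this
  have h3 : Tendsto (fun q : ℝ × A => z q.1 q.2 - z q.1 a) (𝓝[Icc 0 T ×ˢ univ] (t, a))
      (𝓝 0) := by
    refine squeeze_zero_norm' ?_ h2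
    have hb : ∀ᶠ q : ℝ × A in 𝓝[Icc 0 T ×ˢ univ] (t, a), q.2 ∈ ball a ε :=
      nhdsWithin_le_nhds (continuous_snd.continuousAt.eventually_mem (ball_mem_nhds a hε))
    filter_upwards [hb, self_mem_nhdsWithin] with q hq hq'
    exact hst q.2 hq a (mem_ball_self hε) q.1 hq'.1 0 h0
  have := h3.add h1
  simpa [ContinuousWithinAt] using this

/-- First order expansion in time, locally uniform in a parameter. -/
theorem isLittleO_time_increment {F : Type*} [NormedAddCommGroup F] [NormedSpace ℝ F]
    {u u' : ℝ → A → F} {T : ℝ}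
    (hu : ∀ a, ∀ t ∈ Icc 0 T, HasDerivWithinAt (fun s => u s a) (u' t a) (Icc 0 T) t)
    (hu' : ContinuousOn (fun q : ℝ × A => u' q.1 q.2) (Icc 0 T ×ˢ univ))
    {t : ℝ} (ht : t ∈ Icc 0 T) (a : A) :
    (fun q : ℝ × A => u q.1 q.2 - u t q.2 - (q.1 - t) • u' t a)
      =o[𝓝[Icc 0 T ×ˢ univ] (t, a)] fun q => q.1 - t := by
  refine isLittleO_iff.2 fun ε hε => ?_
  obtain ⟨δ, hδ, hb⟩ := Metric.continuousWithinAt_iff.1 (hu' (t, a) ⟨ht, mem_univ _⟩) ε hε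
  filter_upwards [self_mem_nhdsWithin, nhdsWithin_le_nhds (ball_mem_nhds (t, a) hδ)] with q hq hq'
  have hconv : Convex ℝ (Icc 0 T ∩ ball t δ) := (convex_Icc _ _).inter (convex_ball _ _)
  have hq'' : dist q.1 t < δ ∧ dist q.2 a < δ := by simpa [Prod.dist_eq] using hq'
  have h := hconv.norm_image_sub_le_of_norm_hasDerivWithin_le
    (f := fun s => u s q.2 - s • u' t a) (f' := fun s => u' s q.2 - u' t a) (C := ε)
    (x := t) (y := q.1)
    (fun s hs => by
      have := ((hu q.2 s hs.1).mono (inter_subset_left (t := ball t δ))).sub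
        (((hasDerivAt_id s).smul_const (u' t a)).hasDerivWithinAt)
      simpa [Pi.sub_def] using this)
    (fun s hs => by
      rw [← dist_eq_norm]
      refine (hb (x := (s, q.2)) ⟨hs.1, mem_univ _⟩ ?_).le
      rw [Prod.dist_eq]
      exact max_lt hs.2 hq''.2)
    ⟨ht, mem_ball_self hδ⟩ ⟨hq.1, hq''.1⟩
  convert h using 2
  rw [sub_smul]; abel

end Trajectories

/-! ### Joint continuity of the inverse maps -/

section Inverse

variable {E : Type*} [NormedAddCommGroup E] [NormedSpace ℝ E] [FiniteDimensional ℝ E]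

/-- A continuous family of homeomorphisms has a continuous family of inverses. -/
theorem continuousOn_inverse_family {X Y : ℝ → E → E} {I : Set ℝ}
    (hX : ContinuousOn (fun q : ℝ × E => X q.1 q.2) (I ×ˢ univ))
    (hopen : ∀ t ∈ I, IsOpenMap (X t)) (hXY : ∀ t ∈ I, ∀ y, X t (Y t y) = y)
    (hYX : ∀ t ∈ I, ∀ a, Y t (X t a) = a) :
    ContinuousOn (fun q : ℝ × E => Y q.1 q.2) (I ×ˢ univ) := by
  rintro ⟨t₀, y₀⟩ ⟨ht₀, -⟩
  refine Metric.tendsto_nhds.2 fun ε hε => ?_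
  set a₀ := Y t₀ y₀ with ha₀
  -- Only joint continuity is available, so the argument is topological. Since `a₀` is the only
  -- preimage of `y₀` at time `t₀`, the image of the sphere avoids `y₀`; compactness makes the gap
  -- uniform for nearby times.
  have hsph : ∃ δ > 0, ∀ᶠ t in 𝓝[I] t₀, ∀ a ∈ sphere a₀ ε, δ ≤ dist (X t a) y₀ := by
    have hcomp : IsCompact (sphere a₀ ε) := isCompact_sphere _ _
    have hc : ContinuousOn (fun a => dist (X t₀ a) y₀) (sphere a₀ ε) := by
      have : ContinuousOn (fun a => X t₀ a) (sphere a₀ ε) :=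
        hX.comp (f := fun a => (t₀, a)) (by fun_prop) (fun a _ => ⟨ht₀, mem_univ _⟩)
      exact fun a ha => Tendsto.dist (this a ha) tendsto_const_nhds
    rcases (sphere a₀ ε).eq_empty_or_nonempty with he | hne
    · exact ⟨1, one_pos, Eventually.of_forall fun t a ha => by simp [he] at ha⟩
    obtain ⟨b, hb, hmin⟩ := hcomp.exists_isMinOn hne hc
    have hpos : 0 < dist (X t₀ b) y₀ := by
      refine dist_pos.2 fun h => ?_
      have : b = a₀ := by rw [ha₀, ← h, hYX t₀ ht₀]
      rw [this, mem_sphere, dist_self] at hb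
      exact hε.ne hb
    refine ⟨dist (X t₀ b) y₀ / 2, half_pos hpos, ?_⟩
    have : ∀ a ∈ sphere a₀ ε, ∀ᶠ q : E × ℝ in 𝓝 a ×ˢ 𝓝[I] t₀,
        dist (X t₀ b) y₀ / 2 ≤ dist (X q.2 q.1) y₀ := by
      intro a ha
      have h1 : Tendsto (fun q : E × ℝ => X q.2 q.1) (𝓝 a ×ˢ 𝓝[I] t₀) (𝓝 (X t₀ a)) := by
        have h2 := hX (t₀, a) ⟨ht₀, mem_univ _⟩
        rw [ContinuousWithinAt, nhdsWithin_prod_eq, nhdsWithin_univ] at h2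
        exact h2.comp tendsto_prod_swap
      have h2 : Tendsto (fun q : E × ℝ => dist (X q.2 q.1) y₀) (𝓝 a ×ˢ 𝓝[I] t₀)
          (𝓝 (dist (X t₀ a) y₀)) := h1.dist tendsto_const_nhds
      have h3 : dist (X t₀ b) y₀ ≤ dist (X t₀ a) y₀ := hmin ha
      exact (h2.eventually (lt_mem_nhds (b := dist (X t₀ a) y₀) (by linarith))).mono
        fun q hq => hq.le
    have hset : ∀ᶠ q : E × ℝ in 𝓝ˢ (sphere a₀ ε) ×ˢ 𝓝[I] t₀,
        dist (X t₀ b) y₀ / 2 ≤ dist (X q.2 q.1) y₀ := by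
      rw [hcomp.nhdsSet_prod_eq_biSup]
      simpa only [eventually_iSup] using this
    obtain ⟨pa, hpa, pb, hpb, hab⟩ := eventually_prod_iff.1 hset
    exact hpb.mono fun t ht a ha => hab (hpa.self_of_nhdsSet a ha) ht
  obtain ⟨δ, hδ, hev⟩ := hsph
  have hcen : ∀ᶠ t in 𝓝[I] t₀, X t a₀ ∈ ball y₀ δ := by
    have h1 : ContinuousWithinAt (fun t => X t a₀) I t₀ :=
      (hX (t₀, a₀) ⟨ht₀, mem_univ _⟩).comp (f := fun t => (t, a₀)) (by fun_prop)
        (fun t ht => ⟨ht, mem_univ _⟩)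
    refine h1.eventually_mem (isOpen_ball.mem_nhds ?_)
    simpa [ha₀, hXY t₀ ht₀] using hδ
  have hall : ∀ᶠ t in 𝓝[I] t₀, ∀ y ∈ ball y₀ δ, Y t y ∈ ball a₀ ε := by
    filter_upwards [hev, hcen, self_mem_nhdsWithin] with t h1 h2 ht y hy
    have hpre := (convex_ball y₀ δ).isPreconnected
    have hinj : Function.Injective (X t) := fun a b h => by rw [← hYX t ht a, h, hYX t ht b]
    have hU := hopen t ht _ (isOpen_ball (x := a₀) (ε := ε))
    have hW := hopen t ht _ (isClosed_closedBall (x := a₀) (ε := ε)).isOpen_compl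
    have hdisj : Disjoint (X t '' ball a₀ ε) (X t '' (closedBall a₀ ε)ᶜ) :=
      (disjoint_image_iff hinj).2 (disjoint_compl_right.mono_left ball_subset_closedBall)
    have hcover : ball y₀ δ ⊆ X t '' ball a₀ ε ∪ X t '' (closedBall a₀ ε)ᶜ := by
      intro y' hy'
      rcases lt_trichotomy (dist (Y t y') a₀) ε with h | h | h
      · exact Or.inl ⟨Y t y', h, hXY t ht y'⟩
      · have := h1 (Y t y') h
        rw [hXY t ht] at this
        exact absurd (mem_ball.1 hy') (not_lt.2 this)
      · exact Or.inr ⟨Y t y', by simpa using h, hXY t ht y'⟩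
    -- The small ball about `y₀` misses the image of the sphere, so by connectedness it lies on one
    -- side, the side of the image of `a₀`.
    have hsub := hpre.subset_left_of_subset_union hU hW hdisj hcover
      ⟨X t a₀, h2, a₀, mem_ball_self hε, rfl⟩
    obtain ⟨a, ha, hay⟩ := hsub hy
    rw [← hay, hYX t ht]
    exact ha
  rw [nhdsWithin_prod_eq, nhdsWithin_univ]
  filter_upwards [hall.prod_mk (ball_mem_nhds y₀ hδ)] with q hq
  exact hq.1 q.2 hq.2

end Inverse

/-! ### A maximum principle on a slanted backward cone -/

section Cone

variable {E : Type*} [NormedAddCommGroup E] [InnerProductSpace ℝ E] [FiniteDimensional ℝ E]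

/-- Subtract `ε (t - t₀)` and take a maximum point on the compact cone. Above the base one can step
backward in time without leaving the cone, in a direction that moves by `c` along the gradient
relative to the drift `V`. By the differential inequality the penalised function then increases at
rate at least `ε`, so the maximum lies on the base. -/
theorem cone_le_zero {w : ℝ × E → ℝ} {τ : ℝ × E → ℝ} {g : ℝ × E → E} {t₀ t₁ c : ℝ} {y₁ V : E}
    (ht : t₀ ≤ t₁) (hc : 0 ≤ c)
    (hw : ∀ t ∈ Icc t₀ t₁, ∀ y, ‖y - y₁ - (t - t₁) • V‖ ≤ c * (t₁ - t) →
      HasFDerivWithinAt w ((ContinuousLinearMap.toSpanSingleton ℝ (τ (t, y))).comp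
        (ContinuousLinearMap.fst ℝ ℝ E) + (innerSL ℝ (g (t, y))).comp
          (ContinuousLinearMap.snd ℝ ℝ E)) (Icc t₀ t₁ ×ˢ univ) (t, y))
    (hbd : ∀ t ∈ Icc t₀ t₁, ∀ y, ‖y - y₁ - (t - t₁) • V‖ ≤ c * (t₁ - t) →
      τ (t, y) + inner ℝ (g (t, y)) V ≤ c * ‖g (t, y)‖)
    (h₀ : ∀ y, ‖y - y₁ - (t₀ - t₁) • V‖ ≤ c * (t₁ - t₀) → w (t₀, y) ≤ 0) :
    w (t₁, y₁) ≤ 0 := by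
  set S : Set (ℝ × E) := {q | q.1 ∈ Icc t₀ t₁ ∧ ‖q.2 - y₁ - (q.1 - t₁) • V‖ ≤ c * (t₁ - q.1)}
    with hS
  have hSsub : S ⊆ Icc t₀ t₁ ×ˢ univ := fun q hq => ⟨hq.1, mem_univ _⟩
  have hScl : IsClosed S := by
    have h1 : IsClosed {q : ℝ × E | ‖q.2 - y₁ - (q.1 - t₁) • V‖ ≤ c * (t₁ - q.1)} :=
      isClosed_le (by fun_prop) (by fun_prop)
    exact (isClosed_Icc.preimage continuous_fst).inter h1
  have hScomp : IsCompact S := by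
    refine Metric.isCompact_of_isClosed_isBounded hScl ?_
    refine (isBounded_Icc t₀ t₁).prod (isBounded_closedBall (x := y₁)
      (r := (c + ‖V‖) * (t₁ - t₀))) |>.subset ?_
    rintro ⟨t, y⟩ ⟨h1, h2⟩
    refine ⟨h1, ?_⟩
    simp only at h1 h2
    rw [mem_closedBall, dist_eq_norm]
    calc ‖y - y₁‖ = ‖(y - y₁ - (t - t₁) • V) + (t - t₁) • V‖ := by congr 1; abel
      _ ≤ c * (t₁ - t) + (t₁ - t) * ‖V‖ := by
        refine (norm_add_le _ _).trans (add_le_add h2 ?_)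
        rw [norm_smul, Real.norm_eq_abs, abs_sub_comm, abs_of_nonneg (by linarith [h1.2])]
      _ = (c + ‖V‖) * (t₁ - t) := by ring
      _ ≤ (c + ‖V‖) * (t₁ - t₀) := by
        refine mul_le_mul_of_nonneg_left (by linarith [h1.1]) (by positivity)
  have hapex : (t₁, y₁) ∈ S := ⟨right_mem_Icc.2 ht, by simp⟩
  refine le_of_forall_pos_le_add fun ε' hε' => ?_
  set ε := ε' / (t₁ - t₀ + 1) with hεdef
  have hε : 0 < ε := div_pos hε' (by linarith)
  have hcont : ContinuousOn (fun q : ℝ × E => w q - ε * (q.1 - t₀)) S := by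
    refine ContinuousOn.sub (fun q hq => ?_) (by fun_prop)
    exact (hw q.1 hq.1 q.2 hq.2).continuousWithinAt.mono hSsub
  obtain ⟨⟨t, y⟩, hq, hmax⟩ := hScomp.exists_isMaxOn ⟨_, hapex⟩ hcont
  have hval : w (t₁, y₁) - ε * (t₁ - t₀) ≤ w (t, y) - ε * (t - t₀) := hmax hapex
  rcases hq.1.1.eq_or_lt with h | h
  · simp only at h
    subst h
    have h1 := h₀ y hq.2
    have h2 : ε * (t₁ - t₀) ≤ ε' := by
      rw [hεdef, div_mul_eq_mul_div, div_le_iff₀ (by linarith)]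
      nlinarith
    linarith
  · exfalso
    simp only at h
    obtain ⟨e, he, hge⟩ : ∃ e : E, ‖e‖ ≤ 1 ∧ inner ℝ (g (t, y)) e = ‖g (t, y)‖ := by
      rcases eq_or_ne (g (t, y)) 0 with h0 | h0
      · exact ⟨0, by simp, by simp [h0]⟩
      · have hn := norm_ne_zero_iff.2 h0
        refine ⟨‖g (t, y)‖⁻¹ • g (t, y), by rw [norm_smul]; simp [hn], ?_⟩
        rw [inner_smul_right, real_inner_self_eq_norm_sq]
        field_simp
    -- The cone widens at speed `c` about its axis backward in time, so this is an admissible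
    -- direction, and the one of largest growth of the gradient term.
    set d : E := c • e - V with hd
    have hpath : ∀ s ∈ Icc 0 (t - t₀), (t - s, y + s • d) ∈ S := by
      intro s hs
      refine ⟨⟨by linarith [hs.2], by linarith [hs.1, hq.1.2]⟩, ?_⟩
      have hq2 := hq.2
      simp only at hq2 ⊢
      have heq : y + s • d - y₁ - (t - s - t₁) • V = (y - y₁ - (t - t₁) • V) + (s * c) • e := by
        rw [hd]; module
      rw [heq]
      calc _ ≤ ‖y - y₁ - (t - t₁) • V‖ + ‖(s * c) • e‖ := norm_add_le _ _
        _ ≤ c * (t₁ - t) + s * c * 1 := by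
          refine add_le_add hq2 ?_
          rw [norm_smul, Real.norm_eq_abs, abs_of_nonneg (mul_nonneg hs.1 hc)]
          exact mul_le_mul_of_nonneg_left he (mul_nonneg hs.1 hc)
        _ = c * (t₁ - (t - s)) := by ring
    have hder : HasDerivWithinAt (fun s : ℝ => w (t - s, y + s • d) - ε * ((t - s) - t₀))
        (-τ (t, y) + inner ℝ (g (t, y)) d + ε) (Icc 0 (t - t₀)) 0 := by
      have hp : HasDerivWithinAt (fun s : ℝ => (t - s, y + s • d)) ((-1 : ℝ), d)
          (Icc 0 (t - t₀)) 0 := by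
        have h1 : HasDerivAt (fun s : ℝ => t - s) (-1) 0 := by
          simpa using (hasDerivAt_id (0 : ℝ)).const_sub t
        have h2 : HasDerivAt (fun s : ℝ => y + s • d) d 0 := by
          simpa using ((hasDerivAt_id (0 : ℝ)).smul_const d).const_add y
        exact (h1.prodMk h2).hasDerivWithinAt
      have hw' := hw t hq.1 y hq.2
      have hw'' : HasFDerivWithinAt w ((ContinuousLinearMap.toSpanSingleton ℝ (τ (t, y))).comp
        (ContinuousLinearMap.fst ℝ ℝ E) + (innerSL ℝ (g (t, y))).comp
          (ContinuousLinearMap.snd ℝ ℝ E)) (Icc t₀ t₁ ×ˢ univ)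
          ((fun s : ℝ => (t - s, y + s • d)) 0) := by simpa using hw'
      have h3 := hw''.comp_hasDerivWithinAt (0 : ℝ) hp (fun s hs => hSsub (hpath s hs))
      have h4 : HasDerivAt (fun s : ℝ => ε * ((t - s) - t₀)) (-ε) 0 := by
        have := (((hasDerivAt_id (0 : ℝ)).const_sub t).sub_const t₀).const_mul ε
        simpa using this
      have h5 := h3.sub h4.hasDerivWithinAt
      simpa [Function.comp_def, Pi.sub_def] using h5
    have hmono : -τ (t, y) + inner ℝ (g (t, y)) d + ε ≤ 0 := by
      have hne : (𝓝[Ioc 0 (t - t₀)] (0 : ℝ)).NeBot := by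
        rw [nhdsWithin_Ioc_eq_nhdsGT (by linarith)]; infer_instance
      have htend := (hasDerivWithinAt_iff_tendsto_slope'
        (s := Ioc 0 (t - t₀)) (by simp)).1 (hder.mono Ioc_subset_Icc_self)
      refine le_of_tendsto htend ?_
      filter_upwards [self_mem_nhdsWithin] with s hs
      have h1 : w (t - s, y + s • d) - ε * ((t - s) - t₀) ≤ w (t, y) - ε * (t - t₀) :=
        hmax (hpath s (Ioc_subset_Icc_self hs))
      rw [slope_def_field]
      refine div_nonpos_of_nonpos_of_nonneg ?_ (by linarith [hs.1])
      simp only [sub_zero, zero_smul, add_zero]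
      linarith
    have hb := hbd t hq.1 y hq.2
    rw [hd, inner_sub_right, inner_smul_right, hge] at hmono
    linarith

end Cone

variable {N : ℕ}

/-! ### Regularity and derivatives of the Hamilton function -/

section Legendre

/-- The velocity corresponding to a point of the extended phase space. -/
noncomputable def velocity (L : ExtPhase N → ℝ) (z : ExtPhase N) : Conf N :=
  (Function.invFun (legendreMap L) z).2.1

/-- The force `L_x` at the velocity corresponding to a point of the extended phase space. -/
noncomputable def force (L : ExtPhase N → ℝ) (z : ExtPhase N) : Conf N :=
  gradient (fun y => L (y, velocity L z, z.2.2)) z.1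

theorem IsC1Diffeo.bijective {E F : Type*} [NormedAddCommGroup E] [NormedSpace ℝ E]
    [NormedAddCommGroup F] [NormedSpace ℝ F] {f : E → F} (hf : IsC1Diffeo f) :
    Function.Bijective f := by
  obtain ⟨Φ, hΦ⟩ := hf
  have : f = Φ := funext fun z => (hΦ z).symm
  rw [this]
  exact Φ.bijective

theorem IsC1Diffeo.contDiff {E F : Type*} [NormedAddCommGroup E] [NormedSpace ℝ E]
    [NormedAddCommGroup F] [NormedSpace ℝ F] {f : E → F} (hf : IsC1Diffeo f) :
    ContDiff ℝ 1 f := by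
  obtain ⟨Φ, hΦ⟩ := hf
  have : f = Φ := funext fun z => (hΦ z).symm
  rw [this]
  exact Φ.contMDiff.contDiff

theorem IsC1Diffeo.contDiff_invFun {E F : Type*} [NormedAddCommGroup E] [NormedSpace ℝ E]
    [NormedAddCommGroup F] [NormedSpace ℝ F] {f : E → F} (hf : IsC1Diffeo f) :
    ContDiff ℝ 1 (Function.invFun f) := by
  have hb := hf.bijective
  obtain ⟨Φ, hΦ⟩ := hf
  have : Function.invFun f = Φ.symm := by
    funext z
    apply hb.injective
    rw [Function.rightInverse_invFun hb.surjective z, ← hΦ]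
    simp
  rw [this]
  exact Φ.symm.contMDiff.contDiff

theorem IsC1Diffeo.isOpenMap {E F : Type*} [NormedAddCommGroup E] [NormedSpace ℝ E]
    [NormedAddCommGroup F] [NormedSpace ℝ F] {f : E → F} (hf : IsC1Diffeo f) :
    IsOpenMap f := by
  have hb := hf.bijective
  exact IsOpenMap.of_inverse hf.contDiff_invFun.continuous
    (Function.rightInverse_invFun hb.surjective) (Function.leftInverse_invFun hb.injective)

variable {L : ExtPhase N → ℝ}

theorem invFun_legendreMap (hleg : IsC1Diffeo (legendreMap L)) (z : ExtPhase N) :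
    Function.invFun (legendreMap L) z = (z.1, velocity L z, z.2.2) := by
  have h := Function.rightInverse_invFun hleg.bijective.surjective z
  have h1 := congrArg Prod.fst h
  have h2 := congrArg (fun q : ExtPhase N => q.2.2) h
  exact Prod.ext h1 (Prod.ext rfl h2)

theorem contDiff_velocity (hleg : IsC1Diffeo (legendreMap L)) : ContDiff ℝ 1 (velocity L) :=
  contDiff_fst.comp (contDiff_snd.comp hleg.contDiff_invFun)

theorem gradient_velocity (hleg : IsC1Diffeo (legendreMap L)) (z : ExtPhase N) :
    gradient (fun v => L (z.1, v, z.2.2)) (velocity L z) = z.2.1 := by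
  have h := Function.rightInverse_invFun hleg.bijective.surjective z
  rw [invFun_legendreMap hleg] at h
  exact congrArg (fun q : ExtPhase N => q.2.1) h

theorem legendreMap_velocity (hleg : IsC1Diffeo (legendreMap L)) (z : ExtPhase N) :
    legendreMap L (z.1, velocity L z, z.2.2) = z := by
  rw [← invFun_legendreMap hleg]
  exact Function.rightInverse_invFun hleg.bijective.surjective z

theorem gradient_position_eq {u : ExtPhase N} (hL : DifferentiableAt ℝ L u) :
    gradient (fun y => L (y, u.2.1, u.2.2)) u.1 =
      (InnerProductSpace.toDual ℝ (Conf N)).symm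
        ((fderiv ℝ L u).comp (ContinuousLinearMap.inl ℝ (Conf N) (Conf N × ℝ))) := by
  have h : HasFDerivAt (fun y => L (y, u.2.1, u.2.2))
      ((fderiv ℝ L u).comp (ContinuousLinearMap.inl ℝ (Conf N) (Conf N × ℝ))) u.1 :=
    HasFDerivAt.comp (f := fun y => (y, u.2.1, u.2.2)) u.1 hL.hasFDerivAt
      (hasFDerivAt_prodMk_left u.1 u.2)
  rw [gradient, h.fderiv]

theorem contDiff_force (hL : ContDiff ℝ 2 L) (hleg : IsC1Diffeo (legendreMap L)) :
    ContDiff ℝ 1 (force L) := by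
  have hd : Differentiable ℝ L := hL.differentiable (by norm_num)
  have h : force L = fun z => (InnerProductSpace.toDual ℝ (Conf N)).symm
      ((fderiv ℝ L (Function.invFun (legendreMap L) z)).comp
        (ContinuousLinearMap.inl ℝ (Conf N) (Conf N × ℝ))) := by
    funext z
    rw [← gradient_position_eq hd.differentiableAt, invFun_legendreMap hleg]
    rfl
  rw [h]
  have h1 : ContDiff ℝ 1 (fderiv ℝ L) := hL.fderiv_right (by norm_num)
  have h2 : ContDiff ℝ 1 fun z => (fderiv ℝ L (Function.invFun (legendreMap L) z)).comp
      (ContinuousLinearMap.inl ℝ (Conf N) (Conf N × ℝ)) :=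
    (h1.comp hleg.contDiff_invFun).clm_comp contDiff_const
  exact (InnerProductSpace.toDual ℝ (Conf N)).symm.toContinuousLinearEquiv.contDiff.comp h2

theorem fderiv_velocity_point (hL : ContDiff ℝ 2 L) (hleg : IsC1Diffeo (legendreMap L))
    (z : ExtPhase N) (a b : Conf N) (c : ℝ) :
    fderiv ℝ L (z.1, velocity L z, z.2.2) (a, b, c) = inner ℝ (force L z) a + inner ℝ z.2.1 b +
      fderiv ℝ L (z.1, velocity L z, z.2.2) (0, 0, c) := by
  have hd : DifferentiableAt ℝ L (z.1, velocity L z, z.2.2) :=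
    hL.differentiable (by norm_num) _
  have h1 : inner ℝ (force L z) a = fderiv ℝ L (z.1, velocity L z, z.2.2) (a, 0, 0) := by
    rw [force, gradient_position_eq hd, InnerProductSpace.toDual_symm_apply]
    rfl
  have h2 : inner ℝ z.2.1 b = fderiv ℝ L (z.1, velocity L z, z.2.2) (0, b, 0) := by
    have hv : HasFDerivAt (fun v => L (z.1, v, z.2.2))
        ((fderiv ℝ L (z.1, velocity L z, z.2.2)).comp
          ((ContinuousLinearMap.inr ℝ (Conf N) (Conf N × ℝ)).comp
            (ContinuousLinearMap.inl ℝ (Conf N) ℝ))) (velocity L z) :=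
      HasFDerivAt.comp (f := fun v => (z.1, v, z.2.2)) (velocity L z) hd.hasFDerivAt
        (HasFDerivAt.comp (f := fun v => (v, z.2.2)) (velocity L z)
          (hasFDerivAt_prodMk_right z.1 _) (hasFDerivAt_prodMk_left _ z.2.2))
    have hg := gradient_velocity hleg z
    rw [gradient, hv.fderiv] at hg
    rw [← hg, InnerProductSpace.toDual_symm_apply]
    rfl
  rw [h1, h2, ← map_add, ← map_add]
  simp

theorem hamiltonian_eq (hleg : IsC1Diffeo (legendreMap L)) (z : ExtPhase N) :
    hamiltonian L z = inner ℝ z.2.1 (velocity L z) - L (z.1, velocity L z, z.2.2) := by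
  rw [hamiltonian, invFun_legendreMap hleg]

theorem contDiff_hamiltonian (hL : ContDiff ℝ 2 L) (hleg : IsC1Diffeo (legendreMap L)) :
    ContDiff ℝ 1 (hamiltonian L) := by
  have h1 := contDiff_velocity hleg
  have h2 : ContDiff ℝ 1 L := hL.of_le (by norm_num)
  have : hamiltonian L = fun z => inner ℝ z.2.1 (velocity L z) - L (z.1, velocity L z, z.2.2) :=
    funext (hamiltonian_eq hleg)
  rw [this]
  exact ((contDiff_fst.comp contDiff_snd).inner ℝ h1).sub
    (h2.comp (contDiff_fst.prodMk (h1.prodMk (contDiff_snd.comp contDiff_snd))))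

/-- Differentiating `p · v - L` produces `p · dv - L_v · dv`, which cancels because `p = L_v`. What
remains contains no derivative of the velocity, so the partial gradients of `H` in position and
momentum are again C¹. -/
theorem fderiv_hamiltonian (hL : ContDiff ℝ 2 L) (hleg : IsC1Diffeo (legendreMap L))
    (z : ExtPhase N) (a b : Conf N) :
    fderiv ℝ (hamiltonian L) z (a, b, 0) =
      inner ℝ (velocity L z) b - inner ℝ (force L z) a := by
  have h1 : HasFDerivAt (velocity L) (fderiv ℝ (velocity L) z) z :=
    ((contDiff_velocity hleg).differentiable (by norm_num) z).hasFDerivAt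
  have hd : HasFDerivAt L (fderiv ℝ L (z.1, velocity L z, z.2.2)) (z.1, velocity L z, z.2.2) :=
    (hL.differentiable (by norm_num) _).hasFDerivAt
  have hfst : HasFDerivAt (fun z : ExtPhase N => z.1) (ContinuousLinearMap.fst ℝ _ _) z :=
    hasFDerivAt_fst
  have hsnd : HasFDerivAt (fun z : ExtPhase N => z.2) (ContinuousLinearMap.snd ℝ _ _) z :=
    hasFDerivAt_snd
  have h2 : HasFDerivAt (fun z : ExtPhase N => (z.1, velocity L z, z.2.2)) _ z :=
    hfst.prodMk (h1.prodMk hsnd.snd)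
  have h3 : HasFDerivAt (fun z : ExtPhase N => L (z.1, velocity L z, z.2.2)) _ z :=
    HasFDerivAt.comp z hd h2
  have h4 := (hsnd.fst.inner ℝ h1).sub h3
  have h5 : hamiltonian L =
      (fun z => inner ℝ z.2.1 (velocity L z)) - fun z => L (z.1, velocity L z, z.2.2) :=
    funext (hamiltonian_eq hleg)
  rw [h5, h4.fderiv]
  have h6 := fderiv_velocity_point hL hleg z a (fderiv ℝ (velocity L) z (a, b, 0)) 0
  have h7 : fderiv ℝ L (z.1, velocity L z, z.2.2) (0, 0, 0) = 0 := map_zero _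
  simp [fderivInnerCLM_apply, h6, h7, real_inner_comm]
  ring

theorem gradient_hamiltonian_momentum (hL : ContDiff ℝ 2 L) (hleg : IsC1Diffeo (legendreMap L))
    (y q : Conf N) (t : ℝ) :
    gradient (fun q => hamiltonian L (y, q, t)) q = velocity L (y, q, t) := by
  have hd : HasFDerivAt (hamiltonian L) (fderiv ℝ (hamiltonian L) (y, q, t)) (y, q, t) :=
    ((contDiff_hamiltonian hL hleg).differentiable (by norm_num) _).hasFDerivAt
  have h : HasFDerivAt (fun q => hamiltonian L (y, q, t))
      ((fderiv ℝ (hamiltonian L) (y, q, t)).comp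
        ((ContinuousLinearMap.inr ℝ (Conf N) (Conf N × ℝ)).comp
            (ContinuousLinearMap.inl ℝ (Conf N) ℝ))) q :=
      HasFDerivAt.comp (f := fun q => (y, q, t)) q hd
        (HasFDerivAt.comp (f := fun q => (q, t)) q
          (hasFDerivAt_prodMk_right y _) (hasFDerivAt_prodMk_left _ t))
  rw [gradient, h.fderiv]
  refine ext_inner_right ℝ fun b => ?_
  rw [InnerProductSpace.toDual_symm_apply]
  have := fderiv_hamiltonian hL hleg (y, q, t) 0 b
  simp only [inner_zero_right, sub_zero] at this
  simpa using this

theorem gradient_hamiltonian_position (hL : ContDiff ℝ 2 L) (hleg : IsC1Diffeo (legendreMap L))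
    (y q : Conf N) (t : ℝ) :
    gradient (fun y => hamiltonian L (y, q, t)) y = -force L (y, q, t) := by
  have hd : HasFDerivAt (hamiltonian L) (fderiv ℝ (hamiltonian L) (y, q, t)) (y, q, t) :=
    ((contDiff_hamiltonian hL hleg).differentiable (by norm_num) _).hasFDerivAt
  have h : HasFDerivAt (fun y => hamiltonian L (y, q, t))
      ((fderiv ℝ (hamiltonian L) (y, q, t)).comp
        (ContinuousLinearMap.inl ℝ (Conf N) (Conf N × ℝ))) y :=
      HasFDerivAt.comp (f := fun y => (y, q, t)) y hd (hasFDerivAt_prodMk_left y _)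
  rw [gradient, h.fderiv]
  refine ext_inner_right ℝ fun a => ?_
  rw [InnerProductSpace.toDual_symm_apply]
  have := fderiv_hamiltonian hL hleg (y, q, t) a 0
  simp only [inner_zero_right, zero_sub] at this
  rw [inner_neg_left]
  exact this

end Legendre

/-! ### Time variation of the increment between two trajectories -/

section Increments

/-- The second bound follows from the first: the increment has derivative at most `K` times its own
norm, which stability bounds by its norm at time `t`. -/
theorem exists_stable_increment {E A : Type*} [NormedAddCommGroup E] [NormedSpace ℝ E]
    [PseudoMetricSpace A] {f : ℝ → E → E} {z : ℝ → A → E} {T : ℝ} (hT : 0 ≤ T)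
    (hf : ∀ R : ℝ, ∃ K : NNReal, ∀ t ∈ Icc 0 T, LipschitzOnWith K (f t) (closedBall 0 R))
    (hz : ∀ a, ∀ t ∈ Icc 0 T, HasDerivWithinAt (fun s => z s a) (f t (z t a)) (Icc 0 T) t)
    (hz₀ : Continuous (z 0)) (a : A) :
    ∃ M > 0, ∃ ε > 0, ∀ b ∈ ball a ε, ∀ c ∈ ball a ε, ∀ s ∈ Icc 0 T, ∀ t ∈ Icc 0 T,
      ‖z s b - z s c‖ ≤ M * ‖z t b - z t c‖ ∧
      ‖(z s b - z s c) - (z t b - z t c)‖ ≤ M * ‖z t b - z t c‖ * |s - t| := by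
  obtain ⟨M, hM, R, ε, hε, hR, hst⟩ := exists_stable_nhd hT hf hz hz₀ a
  obtain ⟨K, hK⟩ := hf R
  refine ⟨max M (K * M), lt_max_of_lt_left hM, ε, hε, fun b hb c hc s hs t ht => ⟨?_, ?_⟩⟩
  · exact (hst b hb c hc s hs t ht).trans
      (mul_le_mul_of_nonneg_right (le_max_left _ _) (norm_nonneg _))
  · have h := (convex_Icc 0 T).norm_image_sub_le_of_norm_hasDerivWithin_le
      (f := fun r => z r b - z r c) (f' := fun r => f r (z r b) - f r (z r c))
      (C := K * M * ‖z t b - z t c‖) (fun r hr => (hz b r hr).sub (hz c r hr))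
      (fun r hr => by
        have h1 := (hK r hr).norm_sub_le (mem_closedBall_zero_iff.2 (hR b hb r hr))
          (mem_closedBall_zero_iff.2 (hR c hc r hr))
        refine h1.trans ?_
        rw [mul_assoc]
        exact mul_le_mul_of_nonneg_left (hst b hb c hc r hr t ht) K.2) ht hs
    refine h.trans ?_
    rw [Real.norm_eq_abs]
    gcongr
    exact le_max_right _ _

end Increments

/-! ### Rays, and control of momenta by positions -/

/-- The hypotheses on the Lagrangian, the initial function and the family of rays. -/
structure IsRayFamily (L : ExtPhase N → ℝ) (S₀ : Conf N → ℝ) (T : ℝ)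
    (x p : ℝ → Conf N → Conf N) : Prop where
  lagrangian : ContDiff ℝ 2 L
  legendre : IsC1Diffeo (legendreMap L)
  initial : ContDiff ℝ 1 S₀
  pos : 0 < T
  flow : IsHamiltonFlow (hamiltonian L) S₀ T x p
  diffeo : ∀ t ∈ Icc 0 T, IsC1Diffeo (x t)

/-- The Hamiltonian vector field on the phase space. -/
noncomputable def phaseField (L : ExtPhase N → ℝ) (t : ℝ) (z : Conf N × Conf N) :
    Conf N × Conf N :=
  (velocity L (z.1, z.2, t), force L (z.1, z.2, t))

namespace IsRayFamily

variable {L : ExtPhase N → ℝ} {S₀ : Conf N → ℝ} {T : ℝ} {x p : ℝ → Conf N → Conf N}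

theorem hasDerivWithinAt_position (h : IsRayFamily L S₀ T x p) (a : Conf N) {t : ℝ}
    (ht : t ∈ Icc 0 T) :
    HasDerivWithinAt (fun s => x s a) (velocity L (x t a, p t a, t)) (Icc 0 T) t := by
  have := h.flow.position a t ht
  rwa [gradient_hamiltonian_momentum h.lagrangian h.legendre] at this

theorem hasDerivWithinAt_momentum (h : IsRayFamily L S₀ T x p) (a : Conf N) {t : ℝ}
    (ht : t ∈ Icc 0 T) :
    HasDerivWithinAt (fun s => p s a) (force L (x t a, p t a, t)) (Icc 0 T) t := by
  have := h.flow.momentum a t ht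
  rwa [gradient_hamiltonian_position h.lagrangian h.legendre, neg_neg] at this

theorem hasDerivWithinAt_phase (h : IsRayFamily L S₀ T x p) (a : Conf N) (t : ℝ)
    (ht : t ∈ Icc 0 T) :
    HasDerivWithinAt (fun s => (x s a, p s a)) (phaseField L t (x t a, p t a)) (Icc 0 T) t :=
  (h.hasDerivWithinAt_position a ht).prodMk (h.hasDerivWithinAt_momentum a ht)

theorem exists_lipschitz_phaseField (h : IsRayFamily L S₀ T x p) (R : ℝ) :
    ∃ K : NNReal, ∀ t ∈ Icc 0 T, LipschitzOnWith K (phaseField L t) (closedBall 0 R) := by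
  have hC : ContDiff ℝ 1 fun q => (velocity L q, force L q) :=
    (contDiff_velocity h.legendre).prodMk (contDiff_force h.lagrangian h.legendre)
  obtain ⟨K, hK⟩ := (hC.locallyLipschitz.locallyLipschitzOn
    (s := closedBall (0 : ExtPhase N) (max R T))).exists_lipschitzOnWith_of_compact
      (isCompact_closedBall _ _)
  refine ⟨K, fun t ht => LipschitzOnWith.of_dist_le_mul fun z hz w hw => ?_⟩
  have hmem : ∀ z ∈ closedBall (0 : Conf N × Conf N) R,
      (z.1, z.2, t) ∈ closedBall (0 : ExtPhase N) (max R T) := by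
    intro z hz
    rw [mem_closedBall_zero_iff] at hz ⊢
    refine norm_prod_le_iff.2 ⟨?_, norm_prod_le_iff.2 ⟨?_, ?_⟩⟩
    · exact ((norm_fst_le z).trans hz).trans (le_max_left _ _)
    · exact ((norm_snd_le z).trans hz).trans (le_max_left _ _)
    · rw [Real.norm_eq_abs, abs_of_nonneg ht.1]
      exact ht.2.trans (le_max_right _ _)
  have := hK.dist_le_mul _ (hmem z hz) _ (hmem w hw)
  refine this.trans (mul_le_mul_of_nonneg_left ?_ K.2)
  simp [Prod.dist_eq]

theorem continuous_gradient_initial (h : IsRayFamily L S₀ T x p) : Continuous (gradient S₀) :=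
  (InnerProductSpace.toDual ℝ (Conf N)).symm.continuous.comp
    (h.initial.continuous_fderiv (by norm_num))

theorem continuous_phase_zero (h : IsRayFamily L S₀ T x p) :
    Continuous fun a => (x 0 a, p 0 a) := by
  simp only [h.flow.position_zero, h.flow.momentum_zero]
  exact continuous_id.prodMk h.continuous_gradient_initial

theorem continuousOn_phase (h : IsRayFamily L S₀ T x p) :
    ContinuousOn (fun q : ℝ × Conf N => (x q.1 q.2, p q.1 q.2)) (Icc 0 T ×ˢ univ) :=
  continuousOn_of_trajectories (z := fun t a => (x t a, p t a)) h.pos.le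
    h.exists_lipschitz_phaseField h.hasDerivWithinAt_phase h.continuous_phase_zero

theorem continuousOn_extPhase (h : IsRayFamily L S₀ T x p) :
    ContinuousOn (fun q : ℝ × Conf N => (x q.1 q.2, p q.1 q.2, q.1)) (Icc 0 T ×ˢ univ) :=
  h.continuousOn_phase.fst.prodMk (h.continuousOn_phase.snd.prodMk continuousOn_fst)

theorem continuousOn_velocity (h : IsRayFamily L S₀ T x p) :
    ContinuousOn (fun q : ℝ × Conf N => velocity L (x q.1 q.2, p q.1 q.2, q.1))
      (Icc 0 T ×ˢ univ) :=
  (contDiff_velocity h.legendre).continuous.comp_continuousOn h.continuousOn_extPhase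

theorem exists_stable (h : IsRayFamily L S₀ T x p) (a : Conf N) :
    ∃ M > 0, ∃ ε > 0, ∀ b ∈ ball a ε, ∀ c ∈ ball a ε, ∀ s ∈ Icc 0 T, ∀ t ∈ Icc 0 T,
      ‖(x s b, p s b) - (x s c, p s c)‖ ≤ M * ‖(x t b, p t b) - (x t c, p t c)‖ ∧
      ‖((x s b, p s b) - (x s c, p s c)) - ((x t b, p t b) - (x t c, p t c))‖ ≤
        M * ‖(x t b, p t b) - (x t c, p t c)‖ * |s - t| :=
  exists_stable_increment (z := fun t a => (x t a, p t a)) h.pos.le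
    h.exists_lipschitz_phaseField h.hasDerivWithinAt_phase h.continuous_phase_zero a

/-- The difference of the velocities of two neighbouring rays varies slowly in time. -/
theorem exists_velocity_increment_le (h : IsRayFamily L S₀ T x p) {t₀ : ℝ} (ht₀ : t₀ ∈ Icc 0 T)
    (a : Conf N) {κ : ℝ} (hκ : 0 < κ) :
    ∃ ε > 0, ∀ s ∈ Icc 0 T, |s - t₀| < ε → ∀ b ∈ ball a ε, ∀ c ∈ ball a ε,
      ‖(velocity L (x s b, p s b, s) - velocity L (x s c, p s c, s)) -
        (velocity L (x t₀ b, p t₀ b, t₀) - velocity L (x t₀ c, p t₀ c, t₀))‖ ≤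
        κ * ‖(x t₀ b, p t₀ b) - (x t₀ c, p t₀ c)‖ := by
  obtain ⟨M, hM, ε₀, hε₀, hst⟩ := h.exists_stable a
  set ζ₀ : ExtPhase N := (x t₀ a, p t₀ a, t₀) with hζ₀
  -- Both rays vary, so strict differentiability is needed. It linearises the velocity increments at
  -- both times by the same `D`, leaving `D` applied to the change of the phase increment, which is
  -- of order `|s - t₀|`.
  have hstrict : HasStrictFDerivAt (velocity L) (fderiv ℝ (velocity L) ζ₀) ζ₀ :=
    (contDiff_velocity h.legendre).contDiffAt.hasStrictFDerivAt (by norm_num)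
  set D := fderiv ℝ (velocity L) ζ₀ with hD
  set η := κ / (2 * (M + 1)) with hη
  have hηpos : 0 < η := by positivity
  have hev := isLittleO_iff.1 hstrict.isLittleO hηpos
  obtain ⟨δ, hδ, hball⟩ := Metric.mem_nhds_iff.1 hev
  obtain ⟨ε₁, hε₁, hc⟩ := Metric.continuousWithinAt_iff.1
    (h.continuousOn_extPhase (t₀, a) ⟨ht₀, mem_univ _⟩) δ hδ
  have hnear : ∀ s ∈ Icc 0 T, |s - t₀| < ε₁ → ∀ b ∈ ball a ε₁, ∀ c ∈ ball a ε₁,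
      ‖velocity L (x s b, p s b, s) - velocity L (x s c, p s c, s) -
        D ((x s b, p s b, s) - (x s c, p s c, s))‖ ≤
        η * ‖(x s b, p s b) - (x s c, p s c)‖ := by
    intro s hs hst b hb c hc'
    have h1 : ∀ b ∈ ball a ε₁, dist ((x s b, p s b, s) : ExtPhase N) ζ₀ < δ := by
      intro b hb
      refine hc (x := (s, b)) ⟨hs, mem_univ _⟩ ?_
      rw [Prod.dist_eq]
      exact max_lt hst hb
    have h2 : (((x s b, p s b, s), (x s c, p s c, s)) : ExtPhase N × ExtPhase N) ∈
        ball (ζ₀, ζ₀) δ := by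
      rw [mem_ball, Prod.dist_eq]
      exact max_lt (h1 b hb) (h1 c hc')
    have h3 := hball h2
    refine h3.trans (le_of_eq ?_)
    simp [Prod.norm_def]
  set ε₂ := κ / (2 * (‖D‖ * M + 1)) with hε₂
  have hε₂pos : 0 < ε₂ := by positivity
  refine ⟨min ε₀ (min ε₁ ε₂), lt_min hε₀ (lt_min hε₁ hε₂pos), fun s hs hs' b hb c hc' => ?_⟩
  have hb0 : b ∈ ball a ε₀ := ball_subset_ball (min_le_left _ _) hb
  have hc0 : c ∈ ball a ε₀ := ball_subset_ball (min_le_left _ _) hc'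
  have hb1 : b ∈ ball a ε₁ := ball_subset_ball ((min_le_right _ _).trans (min_le_left _ _)) hb
  have hc1 : c ∈ ball a ε₁ := ball_subset_ball ((min_le_right _ _).trans (min_le_left _ _)) hc'
  have hs1 : |s - t₀| < ε₁ := hs'.trans_le ((min_le_right _ _).trans (min_le_left _ _))
  have hs2 : |s - t₀| < ε₂ := hs'.trans_le ((min_le_right _ _).trans (min_le_right _ _))
  obtain ⟨hA, hB⟩ := hst b hb0 c hc0 s hs t₀ ht₀
  have h1 := hnear s hs hs1 b hb1 c hc1
  have h2 := hnear t₀ ht₀ (by simpa using hε₁) b hb1 c hc1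
  set r := ‖(x t₀ b, p t₀ b) - (x t₀ c, p t₀ c)‖ with hr
  have hr0 : 0 ≤ r := norm_nonneg _
  have h3 : ‖D (((x s b, p s b, s) - (x s c, p s c, s)) -
      ((x t₀ b, p t₀ b, t₀) - (x t₀ c, p t₀ c, t₀)))‖ ≤ ‖D‖ * (M * r * |s - t₀|) := by
    refine (D.le_opNorm _).trans (mul_le_mul_of_nonneg_left ?_ (norm_nonneg _))
    refine le_trans (le_of_eq ?_) hB
    simp [Prod.norm_def]
  set A₁ := velocity L (x s b, p s b, s) - velocity L (x s c, p s c, s)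
  set A₂ := velocity L (x t₀ b, p t₀ b, t₀) - velocity L (x t₀ c, p t₀ c, t₀)
  set e₁ : ExtPhase N := (x s b, p s b, s) - (x s c, p s c, s)
  set e₂ : ExtPhase N := (x t₀ b, p t₀ b, t₀) - (x t₀ c, p t₀ c, t₀)
  have h4 : η * (M * r) + η * r = κ / 2 * r := by rw [hη]; field_simp
  have h5 : ‖D‖ * (M * r * |s - t₀|) ≤ κ / 2 * r := by
    have h6 : ‖D‖ * M * ε₂ ≤ κ / 2 := by
      rw [hε₂, mul_div_assoc', div_le_div_iff₀ (by positivity) (by positivity)]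
      nlinarith [mul_nonneg (norm_nonneg D) hM.le]
    calc ‖D‖ * (M * r * |s - t₀|) = ‖D‖ * M * |s - t₀| * r := by ring
      _ ≤ ‖D‖ * M * ε₂ * r := by gcongr
      _ ≤ κ / 2 * r := by gcongr
  calc ‖A₁ - A₂‖ = ‖(A₁ - D e₁) - (A₂ - D e₂) + D (e₁ - e₂)‖ := by
        rw [map_sub D e₁ e₂]; congr 1; abel
    _ ≤ ‖A₁ - D e₁‖ + ‖A₂ - D e₂‖ + ‖D (e₁ - e₂)‖ :=
        (norm_add_le _ _).trans (add_le_add (norm_sub_le _ _) le_rfl)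
    _ ≤ η * (M * r) + η * r + ‖D‖ * (M * r * |s - t₀|) :=
        add_le_add (add_le_add (h1.trans (mul_le_mul_of_nonneg_left hA hηpos.le)) h2) h3
    _ ≤ κ * r := by linarith

theorem exists_other_time (h : IsRayFamily L S₀ T x p) {t₀ : ℝ} (ht₀ : t₀ ∈ Icc 0 T) {ε : ℝ}
    (hε : 0 < ε) : ∃ t ∈ Icc 0 T, t ≠ t₀ ∧ |t - t₀| < ε := by
  have hT := h.pos
  rcases ht₀.2.lt_or_eq with hlt | heq
  · refine ⟨min T (t₀ + ε / 2), ⟨le_min hT.le (by linarith [ht₀.1]), min_le_left _ _⟩,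
      (lt_min hlt (by linarith)).ne', ?_⟩
    rw [abs_of_pos (sub_pos.2 (lt_min hlt (by linarith)))]
    linarith [min_le_right T (t₀ + ε / 2)]
  · have hlt : 0 < t₀ := heq ▸ hT
    refine ⟨max 0 (t₀ - ε / 2), ⟨le_max_left _ _, max_le hT.le (by linarith [ht₀.2])⟩,
      (max_lt hlt (by linarith)).ne, ?_⟩
    rw [abs_of_neg (sub_neg.2 (max_lt hlt (by linarith)))]
    linarith [le_max_right 0 (t₀ - ε / 2)]

/-- Positions at one time control positions at any other time. -/
theorem exists_position_le (h : IsRayFamily L S₀ T x p) {t₀ t₁ : ℝ} (ht₀ : t₀ ∈ Icc 0 T)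
    (ht₁ : t₁ ∈ Icc 0 T) (a : Conf N) :
    ∃ C > 0, ∃ ε > 0, ∀ b ∈ ball a ε, ∀ c ∈ ball a ε,
      ‖x t₁ b - x t₁ c‖ ≤ C * ‖x t₀ b - x t₀ c‖ := by
  have hinv := h.diffeo t₀ ht₀
  -- The diffeomorphism hypothesis is used at two times: the transition map between positions is C¹,
  -- hence locally Lipschitz.
  have hcomp : ContDiff ℝ 1 fun y => x t₁ (Function.invFun (x t₀) y) :=
    (h.diffeo t₁ ht₁).contDiff.comp hinv.contDiff_invFun
  obtain ⟨K, s, hs, hK⟩ := (hcomp.contDiffAt (x := x t₀ a)).exists_lipschitzOnWith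
  have hpre := hinv.contDiff.continuous.continuousAt.preimage_mem_nhds hs
  obtain ⟨ε, hε, hb⟩ := Metric.mem_nhds_iff.1 hpre
  refine ⟨K + 1, by positivity, ε, hε, fun b hb' c hc' => ?_⟩
  have := hK.norm_sub_le (hb hb') (hb hc')
  simp only [Function.leftInverse_invFun hinv.bijective.injective _] at this
  exact this.trans (mul_le_mul_of_nonneg_right (by simp) (norm_nonneg _))

/-- Positions and velocities control momenta. -/
theorem exists_phase_le_velocity (h : IsRayFamily L S₀ T x p) {t₀ : ℝ} (ht₀ : t₀ ∈ Icc 0 T)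
    (a : Conf N) :
    ∃ C > 0, ∃ ε > 0, ∀ b ∈ ball a ε, ∀ c ∈ ball a ε,
      ‖(x t₀ b, p t₀ b) - (x t₀ c, p t₀ c)‖ ≤ C * (‖x t₀ b - x t₀ c‖ +
        ‖velocity L (x t₀ b, p t₀ b, t₀) - velocity L (x t₀ c, p t₀ c, t₀)‖) := by
  set u : Conf N → ExtPhase N := fun b => (x t₀ b, velocity L (x t₀ b, p t₀ b, t₀), t₀) with hu
  obtain ⟨K, s, hs, hK⟩ := (h.legendre.contDiff.contDiffAt (x := u a)).exists_lipschitzOnWith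
  have hemb : ∀ b ∈ univ, (t₀, b) ∈ Icc 0 T ×ˢ (univ : Set (Conf N)) :=
    fun b _ => ⟨ht₀, mem_univ _⟩
  have huc : Continuous u := by
    rw [← continuousOn_univ]
    have h1 : ContinuousOn (fun b : Conf N => (t₀, b)) univ := by fun_prop
    exact (h.continuousOn_extPhase.fst.comp h1 hemb).prodMk
      ((h.continuousOn_velocity.comp h1 hemb).prodMk continuousOn_const)
  obtain ⟨ε, hε, hb⟩ := Metric.mem_nhds_iff.1 (huc.continuousAt.preimage_mem_nhds hs)
  refine ⟨K + 1, by positivity, ε, hε, fun b hb' c hc' => ?_⟩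
  have h1 := hK.norm_sub_le (hb hb') (hb hc')
  have h2 : ∀ b, legendreMap L (u b) = (x t₀ b, p t₀ b, t₀) := fun b =>
    legendreMap_velocity h.legendre (x t₀ b, p t₀ b, t₀)
  rw [h2, h2] at h1
  have h3 : ‖(x t₀ b, p t₀ b) - (x t₀ c, p t₀ c)‖ =
      ‖((x t₀ b, p t₀ b, t₀) : ExtPhase N) - (x t₀ c, p t₀ c, t₀)‖ := by simp [Prod.norm_def]
  rw [h3]
  refine h1.trans ?_
  have h4 : ‖u b - u c‖ ≤ ‖x t₀ b - x t₀ c‖ +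
      ‖velocity L (x t₀ b, p t₀ b, t₀) - velocity L (x t₀ c, p t₀ c, t₀)‖ := by
    refine norm_prod_le_iff.2 ⟨?_, norm_prod_le_iff.2 ⟨?_, ?_⟩⟩
    · simp [hu]
    · simp [hu]
    · simp [hu]; positivity
  exact mul_le_mul (by simp) h4 (norm_nonneg _) (by positivity)

/-- The velocity increment is recovered as a difference quotient of position increments at `t₀` and
at a second time `t₁`; both are controlled by the positions at `t₀`. The error is a small multiple
of the phase increment and is absorbed. -/
theorem exists_phase_le_position_at (h : IsRayFamily L S₀ T x p) {t₀ : ℝ} (ht₀ : t₀ ∈ Icc 0 T)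
    (a : Conf N) :
    ∃ C > 0, ∃ ε > 0, ∀ b ∈ ball a ε, ∀ c ∈ ball a ε,
      ‖(x t₀ b, p t₀ b) - (x t₀ c, p t₀ c)‖ ≤ C * ‖x t₀ b - x t₀ c‖ := by
  obtain ⟨C₁, hC₁, ε₁, hε₁, h1⟩ := h.exists_phase_le_velocity ht₀ a
  -- With this `κ` the error is at most half of the position increment plus half of the velocity
  -- increment, so the latter can be moved to the left. The second time is chosen only afterwards,
  -- inside the resulting interval.
  obtain ⟨ε₂, hε₂, h2⟩ := h.exists_velocity_increment_le ht₀ a (κ := 1 / (2 * C₁)) (by positivity)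
  obtain ⟨t₁, ht₁, hne, hlt⟩ := h.exists_other_time ht₀ hε₂
  obtain ⟨C₂, hC₂, ε₃, hε₃, h3⟩ := h.exists_position_le ht₀ ht₁ a
  have hh : 0 < |t₁ - t₀| := abs_pos.2 (sub_ne_zero.2 hne)
  refine ⟨C₁ * (2 * (C₂ + 1) / |t₁ - t₀| + 2), by positivity, min ε₁ (min ε₂ ε₃),
    lt_min hε₁ (lt_min hε₂ hε₃), fun b hb c hc => ?_⟩
  have sub1 := ball_subset_ball (x := a) (min_le_left ε₁ (min ε₂ ε₃))
  have sub2 := ball_subset_ball (x := a)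
    ((min_le_right ε₁ (min ε₂ ε₃)).trans (min_le_left _ _))
  have sub3 := ball_subset_ball (x := a)
    ((min_le_right ε₁ (min ε₂ ε₃)).trans (min_le_right _ _))
  have k1 := h1 b (sub1 hb) c (sub1 hc)
  have k3 := h3 b (sub3 hb) c (sub3 hc)
  have hconv : Convex ℝ (Icc 0 T ∩ ball t₀ ε₂) := (convex_Icc _ _).inter (convex_ball _ _)
  set δv := velocity L (x t₀ b, p t₀ b, t₀) - velocity L (x t₀ c, p t₀ c, t₀) with hδv
  set r := ‖(x t₀ b, p t₀ b) - (x t₀ c, p t₀ c)‖ with hr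
  have k2 := hconv.norm_image_sub_le_of_norm_hasDerivWithin_le
    (f := fun s => (x s b - x s c) - s • δv)
    (f' := fun s => (velocity L (x s b, p s b, s) - velocity L (x s c, p s c, s)) - δv)
    (C := 1 / (2 * C₁) * r) (x := t₀) (y := t₁)
    (fun s hs => by
      have := (((h.hasDerivWithinAt_position b hs.1).sub
        (h.hasDerivWithinAt_position c hs.1)).mono (inter_subset_left (t := ball t₀ ε₂))).sub
        (((hasDerivAt_id s).smul_const δv).hasDerivWithinAt)
      simpa [Pi.sub_def] using this)
    (fun s hs => h2 s hs.1 hs.2 b (sub2 hb) c (sub2 hc))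
    ⟨ht₀, mem_ball_self hε₂⟩ ⟨ht₁, hlt⟩
  rw [Real.norm_eq_abs] at k2
  have k4 : |t₁ - t₀| * ‖δv‖ ≤ ‖x t₁ b - x t₁ c‖ + ‖x t₀ b - x t₀ c‖ +
      1 / (2 * C₁) * r * |t₁ - t₀| := by
    rw [← Real.norm_eq_abs, ← norm_smul, Real.norm_eq_abs]
    calc ‖(t₁ - t₀) • δv‖ = ‖(x t₁ b - x t₁ c) - (x t₀ b - x t₀ c) -
          ((x t₁ b - x t₁ c) - t₁ • δv - ((x t₀ b - x t₀ c) - t₀ • δv))‖ := by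
          congr 1; rw [sub_smul]; abel
      _ ≤ _ := (norm_sub_le _ _).trans (add_le_add (norm_sub_le _ _) k2)
  set d := ‖x t₀ b - x t₀ c‖ with hd
  have k5 : 1 / (2 * C₁) * r ≤ (d + ‖δv‖) / 2 := by
    calc 1 / (2 * C₁) * r ≤ 1 / (2 * C₁) * (C₁ * (d + ‖δv‖)) := by gcongr
      _ = (d + ‖δv‖) / 2 := by field_simp
  have k6 : |t₁ - t₀| * ‖δv‖ ≤ C₂ * d + d + (d + ‖δv‖) / 2 * |t₁ - t₀| :=
    k4.trans (by gcongr)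
  have k7 : ‖δv‖ ≤ (2 * (C₂ + 1) / |t₁ - t₀| + 1) * d := by
    have : (2 * (C₂ + 1) / |t₁ - t₀| + 1) * d = (2 * (C₂ + 1) * d + |t₁ - t₀| * d) / |t₁ - t₀| := by
      field_simp
    rw [this, le_div_iff₀ hh]
    linarith
  calc r ≤ C₁ * (d + ‖δv‖) := k1
    _ ≤ C₁ * (d + (2 * (C₂ + 1) / |t₁ - t₀| + 1) * d) := by gcongr
    _ = _ := by ring

/-- Near a ray, the phase space distance of two rays is controlled by the distance of their
positions. -/
theorem exists_phase_le_position (h : IsRayFamily L S₀ T x p) {t₀ : ℝ} (ht₀ : t₀ ∈ Icc 0 T)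
    (a : Conf N) :
    ∃ C > 0, ∃ ε > 0, ∀ t ∈ Icc 0 T, |t - t₀| < ε → ∀ b ∈ ball a ε, ∀ c ∈ ball a ε,
      ∀ s ∈ Icc 0 T, ‖(x s b, p s b) - (x s c, p s c)‖ ≤ C * ‖x t b - x t c‖ := by
  obtain ⟨C, hC, ε₁, hε₁, h1⟩ := h.exists_phase_le_position_at ht₀ a
  obtain ⟨M, hM, ε₂, hε₂, h2⟩ := h.exists_stable a
  -- For `|t - t₀|` below `1 / (2 * M * C)` the position increment changes by at most half of its
  -- size at `t₀`; this costs the factor 2 in the constant.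
  refine ⟨2 * M * C, by positivity, min ε₁ (min ε₂ (1 / (2 * M * C))),
    lt_min hε₁ (lt_min hε₂ (by positivity)), fun t ht htt b hb c hc s hs => ?_⟩
  have sub1 := ball_subset_ball (x := a) (min_le_left ε₁ (min ε₂ (1 / (2 * M * C))))
  have sub2 := ball_subset_ball (x := a)
    ((min_le_right ε₁ (min ε₂ (1 / (2 * M * C)))).trans (min_le_left _ _))
  have k1 := h1 b (sub1 hb) c (sub1 hc)
  have k2 := (h2 b (sub2 hb) c (sub2 hc) t ht t₀ ht₀).2
  have k3 := (h2 b (sub2 hb) c (sub2 hc) s hs t₀ ht₀).1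
  have k4 : |t - t₀| ≤ 1 / (2 * M * C) :=
    htt.le.trans ((min_le_right _ _).trans (min_le_right _ _))
  set r := ‖(x t₀ b, p t₀ b) - (x t₀ c, p t₀ c)‖ with hr
  have k5 : ‖(x t b - x t c) - (x t₀ b - x t₀ c)‖ ≤ M * r * |t - t₀| :=
    (norm_fst_le (((x t b, p t b) - (x t c, p t c)) -
      ((x t₀ b, p t₀ b) - (x t₀ c, p t₀ c)))).trans k2
  set d := ‖x t₀ b - x t₀ c‖ with hd
  have k6 : M * r * |t - t₀| ≤ d / 2 := by
    calc M * r * |t - t₀| ≤ M * (C * d) * (1 / (2 * M * C)) := by gcongr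
      _ = d / 2 := by field_simp
  have k7 : d ≤ ‖x t b - x t c‖ + ‖(x t b - x t c) - (x t₀ b - x t₀ c)‖ := by
    calc d = ‖(x t b - x t c) - ((x t b - x t c) - (x t₀ b - x t₀ c))‖ := by
          rw [hd]; congr 1; abel
      _ ≤ _ := norm_sub_le _ _
  calc _ ≤ M * r := k3
    _ ≤ M * (C * (2 * ‖x t b - x t c‖)) := by
        gcongr
        exact k1.trans (by gcongr; linarith)
    _ = _ := by ring

end IsRayFamily

/-! ### Differentiability of the action and existence -/

/-- The differential of a function of `(t, y)` with time derivative `τ` and gradient `g`. -/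
noncomputable def spacetimeDifferential (τ : ℝ) (g : Conf N) : ℝ × Conf N →L[ℝ] ℝ :=
  (ContinuousLinearMap.toSpanSingleton ℝ τ).comp (ContinuousLinearMap.fst ℝ ℝ (Conf N)) +
    (innerSL ℝ g).comp (ContinuousLinearMap.snd ℝ ℝ (Conf N))

theorem spacetimeDifferential_apply (τ : ℝ) (g : Conf N) (q : ℝ × Conf N) :
    spacetimeDifferential τ g q = q.1 * τ + inner ℝ g q.2 := by
  simp [spacetimeDifferential]

theorem exists_taylor_le {E : Type*} [NormedAddCommGroup E] [NormedSpace ℝ E]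
    [FiniteDimensional ℝ E] {L : E → ℝ} (hL : ContDiff ℝ 2 L) (R : ℝ) :
    ∃ K : ℝ, 0 ≤ K ∧ ∀ u ∈ closedBall (0 : E) R, ∀ v ∈ closedBall (0 : E) R,
      ‖L v - L u - fderiv ℝ L u (v - u)‖ ≤ K * ‖v - u‖ ^ 2 := by
  have h1 : ContDiff ℝ 1 (fderiv ℝ L) := hL.fderiv_right (by norm_num)
  obtain ⟨K, hK⟩ := (h1.locallyLipschitz.locallyLipschitzOn
    (s := closedBall (0 : E) R)).exists_lipschitzOnWith_of_compact (isCompact_closedBall _ _)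
  refine ⟨K, K.2, fun u hu v hv => ?_⟩
  -- Restricting to points no farther from `u` than `v` bounds the variation of the differential by
  -- `K * ‖v - u‖`, which yields the square.
  have hconv : Convex ℝ (closedBall (0 : E) R ∩ closedBall u ‖v - u‖) :=
    (convex_closedBall _ _).inter (convex_closedBall _ _)
  have h2 := hconv.norm_image_sub_le_of_norm_hasFDerivWithin_le' (f := L) (f' := fderiv ℝ L)
    (φ := fderiv ℝ L u) (C := K * ‖v - u‖) (x := u) (y := v)
    (fun w _ => (hL.differentiable (by norm_num) w).hasFDerivAt.hasFDerivWithinAt)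
    (fun w hw => by
      refine (hK.norm_sub_le hw.1 hu).trans (mul_le_mul_of_nonneg_left ?_ K.2)
      simpa [dist_eq_norm] using hw.2)
    ⟨hu, mem_closedBall_self (norm_nonneg _)⟩ ⟨hv, by simp [dist_eq_norm]⟩
  rw [pow_two, ← mul_assoc]
  exact h2

namespace IsRayFamily

variable {L : ExtPhase N → ℝ} {S₀ : Conf N → ℝ} {T : ℝ} {x p : ℝ → Conf N → Conf N}

theorem position_invFun (h : IsRayFamily L S₀ T x p) {t : ℝ} (ht : t ∈ Icc 0 T) (y : Conf N) :
    x t (Function.invFun (x t) y) = y :=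
  Function.rightInverse_invFun (h.diffeo t ht).bijective.surjective y

theorem invFun_position (h : IsRayFamily L S₀ T x p) {t : ℝ} (ht : t ∈ Icc 0 T) (a : Conf N) :
    Function.invFun (x t) (x t a) = a :=
  Function.leftInverse_invFun (h.diffeo t ht).bijective.injective a

theorem continuousOn_invFun (h : IsRayFamily L S₀ T x p) :
    ContinuousOn (fun q : ℝ × Conf N => Function.invFun (x q.1) q.2) (Icc 0 T ×ˢ univ) :=
  continuousOn_inverse_family (X := x) (Y := fun t => Function.invFun (x t))
    h.continuousOn_phase.fst (fun t ht => (h.diffeo t ht).isOpenMap)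
    (fun _ ht y => h.position_invFun ht y) (fun _ ht a => h.invFun_position ht a)

theorem mapsTo_invFun (x : ℝ → Conf N → Conf N) (T : ℝ) :
    MapsTo (fun q : ℝ × Conf N => (q.1, Function.invFun (x q.1) q.2)) (Icc 0 T ×ˢ univ)
      (Icc 0 T ×ˢ univ) :=
  fun _ hq => ⟨hq.1, mem_univ _⟩

theorem continuousOn_momentum_invFun (h : IsRayFamily L S₀ T x p) :
    ContinuousOn (fun q : ℝ × Conf N => p q.1 (Function.invFun (x q.1) q.2))
      (Icc 0 T ×ˢ univ) :=
  h.continuousOn_phase.snd.comp (f := fun q : ℝ × Conf N => (q.1, Function.invFun (x q.1) q.2))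
    (continuousOn_fst.prodMk h.continuousOn_invFun) (mapsTo_invFun x T)

theorem continuousOn_lagrangian (h : IsRayFamily L S₀ T x p) :
    ContinuousOn (fun q : ℝ × Conf N =>
      L (x q.1 q.2, velocity L (x q.1 q.2, p q.1 q.2, q.1), q.1)) (Icc 0 T ×ˢ univ) :=
  h.lagrangian.continuous.comp_continuousOn
    (h.continuousOn_phase.fst.prodMk (h.continuousOn_velocity.prodMk continuousOn_fst))

theorem hasDerivWithinAt_rayAction (h : IsRayFamily L S₀ T x p) (a : Conf N) {t : ℝ}
    (ht : t ∈ Icc 0 T) :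
    HasDerivWithinAt (fun s => rayAction L S₀ T x s a)
      (L (x t a, velocity L (x t a, p t a, t), t)) (Icc 0 T) t := by
  set ℓ : ℝ → ℝ := fun s => L (x s a, velocity L (x s a, p s a, s), s) with hℓ
  have hcont : ContinuousOn ℓ (Icc 0 T) :=
    h.continuousOn_lagrangian.comp (f := fun s : ℝ => (s, a)) (by fun_prop)
      (fun s hs => ⟨hs, mem_univ _⟩)
  -- A continuous extension to the whole line gives the fundamental theorem of calculus at the
  -- endpoints too.
  set g : ℝ → ℝ := IccExtend h.pos.le ((Icc 0 T).domRestrict ℓ) with hg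
  have hgc : Continuous g := (continuousOn_iff_continuous_domRestrict.1 hcont).Icc_extend'
  have hgeq : ∀ s ∈ Icc 0 T, g s = ℓ s := fun s hs => by
    rw [hg, IccExtend_of_mem _ _ hs]; rfl
  have hd : HasDerivAt (fun s => S₀ a + ∫ r in (0 : ℝ)..s, g r) (g t) t :=
    (hgc.integral_hasStrictDerivAt 0 t).hasDerivAt.const_add (S₀ a)
  have heq : ∀ s ∈ Icc 0 T, rayAction L S₀ T x s a = S₀ a + ∫ r in (0 : ℝ)..s, g r := by
    intro s hs
    rw [rayAction]
    congr 1
    refine intervalIntegral.integral_congr fun r hr => ?_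
    rw [uIcc_of_le hs.1] at hr
    have hr' : r ∈ Icc 0 T := ⟨hr.1, hr.2.trans hs.2⟩
    have hdw : derivWithin (fun r => x r a) (Icc 0 T) r = velocity L (x r a, p r a, r) :=
      (h.hasDerivWithinAt_position a hr').derivWithin (uniqueDiffOn_Icc h.pos r hr')
    simp only [hdw, hgeq r hr', hℓ]
  have := hd.hasDerivWithinAt.congr (s := Icc 0 T) heq (heq t ht)
  rwa [hgeq t ht] at this

theorem rayAction_zero (L : ExtPhase N → ℝ) (S₀ : Conf N → ℝ) (T : ℝ)
    (x : ℝ → Conf N → Conf N) (a : Conf N) : rayAction L S₀ T x 0 a = S₀ a := by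
  simp [rayAction]

/-- The Lagrangian coordinates `(x, ẋ, t)` along rays are controlled by the phase coordinates. -/
theorem exists_lagrangian_coordinates_le (h : IsRayFamily L S₀ T x p) (a : Conf N) :
    ∃ K R : ℝ, 0 ≤ K ∧ ∀ b ∈ closedBall a 1, ∀ s ∈ Icc 0 T,
      (x s b, velocity L (x s b, p s b, s), s) ∈ closedBall (0 : ExtPhase N) R ∧
      ‖((x s b, velocity L (x s b, p s b, s), s) : ExtPhase N) -
        (x s a, velocity L (x s a, p s a, s), s)‖ ≤
        K * ‖(x s b, p s b) - (x s a, p s a)‖ := by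
  have hcomp : IsCompact (Icc 0 T ×ˢ closedBall a 1) :=
    isCompact_Icc.prod (isCompact_closedBall a 1)
  obtain ⟨R₁, hR₁⟩ := hcomp.exists_bound_of_continuousOn
    (h.continuousOn_extPhase.mono (prod_mono le_rfl (subset_univ _)))
  obtain ⟨K, hK⟩ := (h.legendre.contDiff_invFun.locallyLipschitz.locallyLipschitzOn
    (s := closedBall (0 : ExtPhase N) R₁)).exists_lipschitzOnWith_of_compact
      (isCompact_closedBall _ _)
  obtain ⟨R, hR⟩ := (isCompact_closedBall (0 : ExtPhase N) R₁).exists_bound_of_continuousOn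
    h.legendre.contDiff_invFun.continuous.continuousOn
  refine ⟨K, R, K.2, fun b hb s hs => ?_⟩
  have hmem : ∀ c ∈ closedBall a 1, (x s c, p s c, s) ∈ closedBall (0 : ExtPhase N) R₁ :=
    fun c hc => mem_closedBall_zero_iff.2 (hR₁ (s, c) ⟨hs, hc⟩)
  have hinv : ∀ c, Function.invFun (legendreMap L) (x s c, p s c, s) =
      (x s c, velocity L (x s c, p s c, s), s) := fun c => invFun_legendreMap h.legendre _
  refine ⟨?_, ?_⟩
  · rw [← hinv, mem_closedBall_zero_iff]
    exact hR _ (hmem b hb)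
  · rw [← hinv, ← hinv]
    refine (hK.norm_sub_le (hmem b hb) (hmem a (mem_closedBall_self zero_le_one))).trans
      (mul_le_mul_of_nonneg_left (le_of_eq ?_) K.2)
    simp [Prod.norm_def]

theorem isLittleO_initial (h : IsRayFamily L S₀ T x p) (a : Conf N) :
    (fun b => S₀ b - S₀ a - inner ℝ (gradient S₀ a) (b - a)) =o[𝓝 a] fun b => b - a := by
  have := (h.initial.differentiable (by norm_num) a).hasGradientAt.hasFDerivAt.isLittleO
  simpa using this

/-- The first variation of the action along the rays. -/
theorem isLittleO_rayAction (h : IsRayFamily L S₀ T x p) {t : ℝ} (ht : t ∈ Icc 0 T)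
    (a : Conf N) :
    (fun b => rayAction L S₀ T x t b - rayAction L S₀ T x t a -
      inner ℝ (p t a) (x t b - x t a)) =o[𝓝 a] fun b => x t b - x t a := by
  obtain ⟨C, hC, ε, hε, h1⟩ := h.exists_phase_le_position ht a
  obtain ⟨K₁, R, hK₁, h2⟩ := h.exists_lagrangian_coordinates_le a
  obtain ⟨K₂, hK₂, h3⟩ := exists_taylor_le h.lagrangian R
  have h0 : (0 : ℝ) ∈ Icc 0 T := left_mem_Icc.2 h.pos.le
  set B := K₂ * (K₁ * C) ^ 2 * T with hB
  have hB0 : 0 ≤ B := mul_nonneg (by positivity) h.pos.le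
  refine isLittleO_iff.2 fun η hη => ?_
  have hxc : Continuous (x t) := (h.diffeo t ht).contDiff.continuous
  -- This threshold turns the accumulated quadratic error `B * d ^ 2` into at most `η / 2 * d`; the
  -- other half of `η` is reserved for the expansion of `S₀`.
  have hev : ∀ᶠ b in 𝓝 a, ‖x t b - x t a‖ < η / (2 * (B + 1)) := by
    have : Tendsto (fun b => ‖x t b - x t a‖) (𝓝 a) (𝓝 0) := by
      have hc : Continuous fun b => ‖x t b - x t a‖ := by fun_prop
      simpa using hc.tendsto a
    exact this.eventually (gt_mem_nhds (by positivity))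
  filter_upwards [hev, isLittleO_iff.1 (h.isLittleO_initial a) (c := η / (2 * C)) (by positivity),
    ball_mem_nhds a hε, closedBall_mem_nhds a one_pos] with b hb1 hb2 hb3 hb4
  set d := ‖x t b - x t a‖ with hd
  have hz : ∀ s ∈ Icc 0 T, ‖(x s b, p s b) - (x s a, p s a)‖ ≤ C * d := fun s hs =>
    h1 t ht (by simpa using hε) b hb3 a (mem_ball_self hε) s hs
  have hba : ‖b - a‖ ≤ C * d := by
    have := (norm_fst_le _).trans (hz 0 h0)
    simpa [h.flow.position_zero] using this
  set G : ℝ → ℝ := fun s => rayAction L S₀ T x s b - rayAction L S₀ T x s a -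
    inner ℝ (p s a) (x s b - x s a) with hG
  have hG0 : ‖G 0‖ ≤ η / 2 * d := by
    simp only [hG, rayAction_zero, h.flow.position_zero, h.flow.momentum_zero]
    refine hb2.trans ?_
    calc η / (2 * C) * ‖b - a‖ ≤ η / (2 * C) * (C * d) := by gcongr
      _ = η / 2 * d := by field_simp
  -- Since `p = L_v` and `p' = L_x`, the derivative of `G` is exactly the second order Taylor
  -- remainder of `L` between the two rays.
  have hGd := (convex_Icc 0 T).norm_image_sub_le_of_norm_hasDerivWithin_le (f := G)
    (f' := fun s => L (x s b, velocity L (x s b, p s b, s), s) -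
      L (x s a, velocity L (x s a, p s a, s), s) -
      (inner ℝ (p s a) (velocity L (x s b, p s b, s) - velocity L (x s a, p s a, s)) +
        inner ℝ (force L (x s a, p s a, s)) (x s b - x s a)))
    (C := K₂ * (K₁ * C) ^ 2 * d ^ 2)
    (fun s hs => ((h.hasDerivWithinAt_rayAction b hs).sub (h.hasDerivWithinAt_rayAction a hs)).sub
      ((h.hasDerivWithinAt_momentum a hs).inner ℝ
        ((h.hasDerivWithinAt_position b hs).sub (h.hasDerivWithinAt_position a hs))))
    (fun s hs => by
      obtain ⟨hbR, hbK⟩ := h2 b hb4 s hs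
      obtain ⟨haR, -⟩ := h2 a (mem_closedBall_self zero_le_one) s hs
      have hT := h3 _ haR _ hbR
      have hsub : ((x s b, velocity L (x s b, p s b, s), s) : ExtPhase N) -
          (x s a, velocity L (x s a, p s a, s), s) = (x s b - x s a,
            velocity L (x s b, p s b, s) - velocity L (x s a, p s a, s), 0) := by simp
      have hf := fderiv_velocity_point h.lagrangian h.legendre (x s a, p s a, s) (x s b - x s a)
        (velocity L (x s b, p s b, s) - velocity L (x s a, p s a, s)) 0
      have hzero : fderiv ℝ L (x s a, velocity L (x s a, p s a, s), s) (0, 0, 0) = 0 :=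
        map_zero _
      rw [hsub] at hT hbK
      simp only at hf
      rw [hf, hzero, add_zero, add_comm (inner ℝ (force L _) _)] at hT
      refine hT.trans ?_
      rw [mul_assoc, ← mul_pow]
      refine mul_le_mul_of_nonneg_left (pow_le_pow_left₀ (norm_nonneg _) (hbK.trans ?_) 2) hK₂
      rw [mul_assoc]
      exact mul_le_mul_of_nonneg_left (hz s hs) hK₁)
    h0 ht
  have hGt : ‖G t‖ ≤ ‖G 0‖ + ‖G t - G 0‖ := by
    calc ‖G t‖ = ‖G 0 + (G t - G 0)‖ := by congr 1; abel
      _ ≤ _ := norm_add_le _ _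
  have hd0 : 0 ≤ d := norm_nonneg _
  have hBd : K₂ * (K₁ * C) ^ 2 * d ^ 2 * ‖t - 0‖ ≤ η / 2 * d := by
    rw [sub_zero, Real.norm_eq_abs, abs_of_nonneg ht.1]
    calc K₂ * (K₁ * C) ^ 2 * d ^ 2 * t ≤ K₂ * (K₁ * C) ^ 2 * d ^ 2 * T := by
          gcongr; exact ht.2
      _ = B * d * d := by rw [hB]; ring
      _ ≤ (B + 1) * (η / (2 * (B + 1))) * d := by gcongr; linarith
      _ = η / 2 * d := by field_simp
  change ‖G t‖ ≤ η * d
  linarith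

theorem hasFDerivAt_action (h : IsRayFamily L S₀ T x p) {t : ℝ} (ht : t ∈ Icc 0 T)
    (y : Conf N) :
    HasFDerivAt (action L S₀ T x t) (innerSL ℝ (p t (Function.invFun (x t) y))) y := by
  refine HasFDerivAt.of_isLittleO ?_
  have h1 : Tendsto (Function.invFun (x t)) (𝓝 y) (𝓝 (Function.invFun (x t) y)) :=
    (h.diffeo t ht).contDiff_invFun.continuous.tendsto y
  have h2 := (h.isLittleO_rayAction ht (Function.invFun (x t) y)).comp_tendsto h1
  simpa [Function.comp_def, h.position_invFun ht, action] using h2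

theorem hasGradientAt_action (h : IsRayFamily L S₀ T x p) {t : ℝ} (ht : t ∈ Icc 0 T)
    (y : Conf N) :
    HasGradientAt (action L S₀ T x t) (p t (Function.invFun (x t) y)) y :=
  h.hasFDerivAt_action ht y

/-- The label of the ray through the moving point is known to be continuous only, so it is never
differentiated. The increment is split into a change of time along the moving ray, whose expansion
is uniform in the label, and a change of label at the fixed time `t`, given by the first variation.
-/
theorem hasFDerivWithinAt_action (h : IsRayFamily L S₀ T x p) {t : ℝ} (ht : t ∈ Icc 0 T)
    (y : Conf N) :
    HasFDerivWithinAt (fun q : ℝ × Conf N => action L S₀ T x q.1 q.2)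
      (spacetimeDifferential (-hamiltonian L (y, p t (Function.invFun (x t) y), t))
        (p t (Function.invFun (x t) y))) (Icc 0 T ×ˢ univ) (t, y) := by
  set a := Function.invFun (x t) y with ha
  have hxa : x t a = y := h.position_invFun ht y
  set v := velocity L (x t a, p t a, t) with hv
  set ℓ := L (x t a, v, t) with hℓ
  set F := 𝓝[Icc 0 T ×ˢ univ] ((t, y) : ℝ × Conf N) with hF
  set Y : ℝ × Conf N → Conf N := fun q => Function.invFun (x q.1) q.2 with hY
  have hYt : Tendsto (fun q : ℝ × Conf N => (q.1, Y q)) F (𝓝[Icc 0 T ×ˢ univ] (t, a)) := by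
    refine tendsto_nhdsWithin_of_tendsto_nhds_of_eventually_within _ ?_
      (eventually_nhdsWithin_of_forall fun q hq => mapsTo_invFun x T hq)
    exact (continuousOn_fst.prodMk h.continuousOn_invFun) (t, y) ⟨ht, mem_univ _⟩
  have hmem : ∀ᶠ q in F, q ∈ Icc 0 T ×ˢ (univ : Set (Conf N)) := self_mem_nhdsWithin
  have e1 : (fun q : ℝ × Conf N => rayAction L S₀ T x q.1 (Y q) - rayAction L S₀ T x t (Y q) -
      (q.1 - t) • ℓ) =o[F] fun q => q.1 - t :=
    (isLittleO_time_increment (u := fun s b => rayAction L S₀ T x s b)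
      (fun b s hs => h.hasDerivWithinAt_rayAction b hs) h.continuousOn_lagrangian ht a).comp_tendsto
      hYt
  have e2 : (fun q : ℝ × Conf N => x q.1 (Y q) - x t (Y q) - (q.1 - t) • v)
      =o[F] fun q => q.1 - t :=
    (isLittleO_time_increment (u := x)
      (fun b s hs => h.hasDerivWithinAt_position b hs) h.continuousOn_velocity ht a).comp_tendsto
      hYt
  have e3 : (fun q : ℝ × Conf N => rayAction L S₀ T x t (Y q) - rayAction L S₀ T x t a -
      inner ℝ (p t a) (x t (Y q) - x t a)) =o[F] fun q => x t (Y q) - x t a :=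
    (h.isLittleO_rayAction ht a).comp_tendsto
      (tendsto_snd.comp (hYt.mono_right (nhdsWithin_le_nhds.trans_eq nhds_prod_eq)))
  have o1 : (fun q : ℝ × Conf N => q.1 - t) =O[F] fun q => q - (t, y) :=
    IsBigO.of_bound 1 (Eventually.of_forall fun q => by
      rw [one_mul]; exact norm_fst_le (q - (t, y)))
  have o2 : (fun q : ℝ × Conf N => q.2 - y) =O[F] fun q => q - (t, y) :=
    IsBigO.of_bound 1 (Eventually.of_forall fun q => by
      rw [one_mul]; exact norm_snd_le (q - (t, y)))
  have o3 : (fun q : ℝ × Conf N => x t (Y q) - x t a) =O[F] fun q => q - (t, y) := by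
    have o4 : (fun q : ℝ × Conf N => (q.1 - t) • v) =O[F] fun q => q - (t, y) := by
      refine IsBigO.trans (IsBigO.of_bound ‖v‖ (Eventually.of_forall fun q => ?_)) o1
      rw [norm_smul, mul_comm]
    refine ((o2.sub (e2.isBigO.trans o1)).sub o4).congr' ?_ EventuallyEq.rfl
    filter_upwards [hmem] with q hq
    rw [hxa, show x q.1 (Y q) = q.2 from h.position_invFun hq.1 q.2]
    abel
  have e4 : (fun q : ℝ × Conf N => inner ℝ (p t a) (x q.1 (Y q) - x t (Y q) - (q.1 - t) • v))
      =o[F] fun q => q.1 - t :=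
    ((innerSL ℝ (p t a)).isBigO_comp _ F).trans_isLittleO e2
  -- The last term replaces the position of the moving ray at time `t` by its position at time
  -- `q.1`, which is `q.2`; this turns the time coefficient `L` into `L - p · v = -H`.
  have hsum := ((e1.trans_isBigO o1).add (e3.trans_isBigO o3)).sub (e4.trans_isBigO o1)
  refine HasFDerivWithinAt.of_isLittleO (hsum.congr' ?_ EventuallyEq.rfl)
  filter_upwards [hmem] with q hq
  have hx1 : x q.1 (Y q) = q.2 := h.position_invFun hq.1 q.2
  have hH : hamiltonian L (y, p t a, t) = inner ℝ (p t a) v - ℓ := by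
    rw [hamiltonian_eq h.legendre, hℓ, hv, hxa]
  rw [spacetimeDifferential_apply, hH, hx1, hxa]
  simp only [action, inner_sub_right, inner_smul_right, smul_eq_mul, Prod.fst_sub, Prod.snd_sub]
  ring

theorem continuousOn_differential (h : IsRayFamily L S₀ T x p) :
    ContinuousOn (fun q : ℝ × Conf N => spacetimeDifferential
      (-hamiltonian L (q.2, p q.1 (Function.invFun (x q.1) q.2), q.1))
      (p q.1 (Function.invFun (x q.1) q.2))) (Icc 0 T ×ˢ univ) := by
  have hp := h.continuousOn_momentum_invFun
  have hH : ContinuousOn (fun q : ℝ × Conf N =>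
      -hamiltonian L (q.2, p q.1 (Function.invFun (x q.1) q.2), q.1)) (Icc 0 T ×ˢ univ) :=
    ((contDiff_hamiltonian h.lagrangian h.legendre).continuous.comp_continuousOn
      (continuousOn_snd.prodMk (hp.prodMk continuousOn_fst))).neg
  refine ContinuousOn.add ?_ ?_
  · exact ((ContinuousLinearMap.toSpanSingletonCLE (𝕜 := ℝ) (E := ℝ)).continuous.comp_continuousOn
      hH).clm_comp continuousOn_const
  · exact ((innerSL ℝ).continuous.comp_continuousOn hp).clm_comp continuousOn_const

theorem isHJSolution_action (h : IsRayFamily L S₀ T x p) :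
    IsHJSolution (hamiltonian L) S₀ T (action L S₀ T x) where
  contDiffOn := by
    have hu : UniqueDiffOn ℝ (Icc 0 T ×ˢ (univ : Set (Conf N))) :=
      (uniqueDiffOn_Icc h.pos).prod uniqueDiffOn_univ
    have := (contDiffOn_succ_iff_hasFDerivWithinAt_of_uniqueDiffOn (n := 0)
      (f := fun q : ℝ × Conf N => action L S₀ T x q.1 q.2) hu).2
      ⟨by simp, _, contDiffOn_zero.2 h.continuousOn_differential,
        fun q hq => h.hasFDerivWithinAt_action hq.1 q.2⟩
    simpa using this
  equation t ht y := by
    rw [(h.hasGradientAt_action ht y).gradient]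
    have hp : HasDerivWithinAt (fun s : ℝ => (s, y)) ((1 : ℝ), (0 : Conf N)) (Icc 0 T) t :=
      (hasDerivWithinAt_id t _).prodMk (hasDerivWithinAt_const t _ y)
    have hm : MapsTo (fun s : ℝ => (s, y)) (Icc 0 T) (Icc 0 T ×ˢ univ) :=
      fun s hs => ⟨hs, mem_univ _⟩
    have h1 := (h.hasFDerivWithinAt_action ht y).comp_hasDerivWithinAt t hp hm
    have h2 : derivWithin (fun s => action L S₀ T x s y) (Icc 0 T) t = _ :=
      h1.derivWithin (uniqueDiffOn_Icc h.pos t ht)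
    rw [h2, spacetimeDifferential_apply]
    simp
  initial y := by
    have h0 : (0 : ℝ) ∈ Icc 0 T := left_mem_Icc.2 h.pos.le
    have : Function.invFun (x 0) y = y := by
      simpa [h.flow.position_zero] using h.position_invFun h0 y
    rw [action, rayAction_zero, this]

end IsRayFamily

/-! ### Differentials of arbitrary C¹ solutions and their differences -/

namespace IsHJSolution

variable {H : ExtPhase N → ℝ} {S₀ : Conf N → ℝ} {T : ℝ} {S : ℝ → Conf N → ℝ}

theorem hasFDerivAt_slice (hS : IsHJSolution H S₀ T S) {t : ℝ} (ht : t ∈ Icc 0 T)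
    (y : Conf N) :
    HasFDerivAt (S t) ((fderivWithin ℝ (fun q : ℝ × Conf N => S q.1 q.2) (Icc 0 T ×ˢ univ)
        (t, y)).comp (ContinuousLinearMap.inr ℝ ℝ (Conf N))) y := by
  have hd := (hS.contDiffOn.differentiableOn (by norm_num) (t, y)
    ⟨ht, mem_univ _⟩).hasFDerivWithinAt
  have h1 := hd.comp y ((hasFDerivAt_prodMk_right t y).hasFDerivWithinAt (s := univ))
    (fun z _ => ⟨ht, mem_univ _⟩)
  exact hasFDerivWithinAt_univ.1 h1

theorem continuousOn_gradient (hS : IsHJSolution H S₀ T S) (hT : 0 < T) :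
    ContinuousOn (fun q : ℝ × Conf N => gradient (S q.1) q.2) (Icc 0 T ×ˢ univ) := by
  have hu : UniqueDiffOn ℝ (Icc 0 T ×ˢ (univ : Set (Conf N))) :=
    (uniqueDiffOn_Icc hT).prod uniqueDiffOn_univ
  have h1 := hS.contDiffOn.continuousOn_fderivWithin hu (by norm_num)
  have h2 := (InnerProductSpace.toDual ℝ (Conf N)).symm.continuous.comp_continuousOn
    (h1.clm_comp (continuousOn_const (c := ContinuousLinearMap.inr ℝ ℝ (Conf N))))
  refine h2.congr fun q hq => ?_
  rw [gradient, (hS.hasFDerivAt_slice hq.1 q.2).fderiv]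
  rfl

theorem hasFDerivWithinAt (hS : IsHJSolution H S₀ T S) (hT : 0 < T) {t : ℝ}
    (ht : t ∈ Icc 0 T) (y : Conf N) :
    HasFDerivWithinAt (fun q : ℝ × Conf N => S q.1 q.2)
      (spacetimeDifferential (-H (y, gradient (S t) y, t)) (gradient (S t) y))
      (Icc 0 T ×ˢ univ) (t, y) := by
  have hd := (hS.contDiffOn.differentiableOn (by norm_num) (t, y)
    ⟨ht, mem_univ _⟩).hasFDerivWithinAt
  set A := fderivWithin ℝ (fun q : ℝ × Conf N => S q.1 q.2) (Icc 0 T ×ˢ univ) (t, y) with hA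
  have hp : HasDerivWithinAt (fun s : ℝ => (s, y)) ((1 : ℝ), (0 : Conf N)) (Icc 0 T) t :=
    (hasDerivWithinAt_id t _).prodMk (hasDerivWithinAt_const t _ y)
  have hm : MapsTo (fun s : ℝ => (s, y)) (Icc 0 T) (Icc 0 T ×ˢ univ) :=
    fun s hs => ⟨hs, mem_univ _⟩
  have h0 := hd.comp_hasDerivWithinAt t hp hm
  have h1 : derivWithin (fun s => S s y) (Icc 0 T) t = A (1, 0) :=
    h0.derivWithin (uniqueDiffOn_Icc hT t ht)
  have h2 : -H (y, gradient (S t) y, t) = A (1, 0) := by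
    rw [← hS.equation t ht y, neg_neg, h1]
  have h3 : ∀ η, inner ℝ (gradient (S t) y) η = A (0, η) := by
    intro η
    rw [gradient, (hS.hasFDerivAt_slice ht y).fderiv, InnerProductSpace.toDual_symm_apply]
    rfl
  have h4 : spacetimeDifferential (-H (y, gradient (S t) y, t)) (gradient (S t) y) = A := by
    refine ContinuousLinearMap.ext fun q => ?_
    rw [spacetimeDifferential_apply, h2, h3, ← smul_eq_mul, ← map_smul, ← map_add]
    simp
  rw [h4]
  exact hd

end IsHJSolution

theorem spacetimeDifferential_sub (τ₁ τ₂ : ℝ) (g₁ g₂ : Conf N) :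
    spacetimeDifferential τ₁ g₁ - spacetimeDifferential τ₂ g₂ =
      spacetimeDifferential (τ₁ - τ₂) (g₁ - g₂) := by
  refine ContinuousLinearMap.ext fun q => ?_
  simp only [sub_apply, spacetimeDifferential_apply, inner_sub_left]
  ring

theorem spacetimeDifferential_neg (τ : ℝ) (g : Conf N) :
    spacetimeDifferential (-τ) (-g) = -spacetimeDifferential τ g := by
  refine ContinuousLinearMap.ext fun q => ?_
  simp only [neg_apply, spacetimeDifferential_apply, inner_neg_left]
  ring

/-- A function that is transported with bounded speed and vanishes on the base of a cone vanishes
at the apex. -/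
theorem cone_eq_zero {w : ℝ × Conf N → ℝ} {τ : ℝ × Conf N → ℝ} {g : ℝ × Conf N → Conf N}
    {t₀ t₁ c : ℝ} {y₁ V : Conf N} (ht : t₀ ≤ t₁) (hc : 0 ≤ c)
    (hw : ∀ t ∈ Icc t₀ t₁, ∀ y, ‖y - y₁ - (t - t₁) • V‖ ≤ c * (t₁ - t) →
      HasFDerivWithinAt w (spacetimeDifferential (τ (t, y)) (g (t, y)))
        (Icc t₀ t₁ ×ˢ univ) (t, y))
    (hbd : ∀ t ∈ Icc t₀ t₁, ∀ y, ‖y - y₁ - (t - t₁) • V‖ ≤ c * (t₁ - t) →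
      |τ (t, y) + inner ℝ (g (t, y)) V| ≤ c * ‖g (t, y)‖)
    (h₀ : ∀ y, ‖y - y₁ - (t₀ - t₁) • V‖ ≤ c * (t₁ - t₀) → w (t₀, y) = 0) :
    w (t₁, y₁) = 0 := by
  refine le_antisymm ?_ ?_
  · exact cone_le_zero ht hc hw (fun t ht y hy => (le_abs_self _).trans (hbd t ht y hy))
      (fun y hy => (h₀ y hy).le)
  · have := cone_le_zero (w := fun q => -w q) (τ := fun q => -τ q) (g := fun q => -g q) ht hc
      (fun t ht y hy => by
        have h1 := (hw t ht y hy).neg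
        rw [← spacetimeDifferential_neg] at h1
        exact h1)
      (fun t ht y hy => by
        rw [norm_neg, inner_neg_left]
        linarith [neg_abs_le (τ (t, y) + inner ℝ (g (t, y)) V), hbd t ht y hy])
      (fun y hy => by simp [h₀ y hy])
    linarith

/-! ### Uniqueness -/

namespace IsRayFamily

variable {L : ExtPhase N → ℝ} {S₀ : Conf N → ℝ} {T : ℝ} {x p : ℝ → Conf N → Conf N}

/-- Near a point where two solutions have the same gradient, their difference is transported
nearly along the ray through that point. -/
theorem exists_transport_le (h : IsRayFamily L S₀ T x p) {S S' : ℝ → Conf N → ℝ}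
    (hS : IsHJSolution (hamiltonian L) S₀ T S) (hS' : IsHJSolution (hamiltonian L) S₀ T S')
    {t₀ : ℝ} (ht₀ : t₀ ∈ Icc 0 T) {y₀ : Conf N} (hg : gradient (S t₀) y₀ = gradient (S' t₀) y₀)
    {c : ℝ} (hc : 0 < c) :
    ∃ δ > 0, ∀ t ∈ Icc 0 T, ∀ y, dist (t, y) (t₀, y₀) < δ →
      |(-hamiltonian L (y, gradient (S t) y, t) - -hamiltonian L (y, gradient (S' t) y, t)) +
        inner ℝ (gradient (S t) y - gradient (S' t) y) (velocity L (y₀, gradient (S' t₀) y₀, t₀))|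
        ≤ c * ‖gradient (S t) y - gradient (S' t) y‖ := by
  set ζ₀ : ExtPhase N := (y₀, gradient (S' t₀) y₀, t₀) with hζ₀
  -- Near the common value of the two gradients, `H` is linear in the momentum increment up to the
  -- factor `c`, with coefficient `H_p`, the velocity.
  have hstrict : HasStrictFDerivAt (hamiltonian L) (fderiv ℝ (hamiltonian L) ζ₀) ζ₀ :=
    (contDiff_hamiltonian h.lagrangian h.legendre).contDiffAt.hasStrictFDerivAt (by norm_num)
  have hev := isLittleO_iff.1 hstrict.isLittleO hc
  have hlift : ∀ S : ℝ → Conf N → ℝ, IsHJSolution (hamiltonian L) S₀ T S →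
      ContinuousWithinAt (fun q : ℝ × Conf N => ((q.2, gradient (S q.1) q.2, q.1) : ExtPhase N))
        (Icc 0 T ×ˢ univ) (t₀, y₀) := fun S hS =>
    (continuousOn_snd.prodMk ((hS.continuousOn_gradient h.pos).prodMk continuousOn_fst)) _
      ⟨ht₀, mem_univ _⟩
  have h1 := hlift S hS
  have h2 := hlift S' hS'
  simp only [ContinuousWithinAt, hg] at h1 h2
  have h3 := (h1.prodMk_nhds h2).eventually hev
  obtain ⟨δ, hδ, hb⟩ := Metric.mem_nhdsWithin_iff.1 h3
  refine ⟨δ, hδ, fun t ht y hty => ?_⟩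
  have h4 : ‖hamiltonian L (y, gradient (S t) y, t) - hamiltonian L (y, gradient (S' t) y, t) -
      fderiv ℝ (hamiltonian L) ζ₀ ((y, gradient (S t) y, t) - (y, gradient (S' t) y, t))‖ ≤
      c * ‖((y, gradient (S t) y, t) : ExtPhase N) - (y, gradient (S' t) y, t)‖ :=
    hb (a := (t, y)) ⟨hty, ht, mem_univ _⟩
  have h5 : ((y, gradient (S t) y, t) : ExtPhase N) - (y, gradient (S' t) y, t) =
      (0, gradient (S t) y - gradient (S' t) y, 0) := by simp
  rw [h5, fderiv_hamiltonian h.lagrangian h.legendre, inner_zero_right, sub_zero,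
    Real.norm_eq_abs] at h4
  have h6 : ‖((0, gradient (S t) y - gradient (S' t) y, 0) : ExtPhase N)‖ =
      ‖gradient (S t) y - gradient (S' t) y‖ := by simp [Prod.norm_def]
  rw [h6] at h4
  rw [real_inner_comm, ← abs_neg]
  convert h4 using 2
  ring

theorem exists_displacement_le (h : IsRayFamily L S₀ T x p) {t₀ : ℝ} (ht₀ : t₀ ∈ Icc 0 T)
    (a : Conf N) {c : ℝ} (hc : 0 < c) :
    ∃ δ > 0, ∀ s ∈ Icc 0 T, |s - t₀| < δ → ∀ t ∈ Icc 0 T, |t - t₀| < δ → ∀ b ∈ ball a δ,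
      ‖x s b - x t b - (s - t) • velocity L (x t₀ a, p t₀ a, t₀)‖ ≤ c * |s - t| := by
  obtain ⟨δ, hδ, hb⟩ := Metric.continuousWithinAt_iff.1
    (h.continuousOn_velocity (t₀, a) ⟨ht₀, mem_univ _⟩) c hc
  refine ⟨δ, hδ, fun s hs hs' t ht ht' b hb' => ?_⟩
  set V := velocity L (x t₀ a, p t₀ a, t₀) with hV
  have hconv : Convex ℝ (Icc 0 T ∩ ball t₀ δ) := (convex_Icc _ _).inter (convex_ball _ _)
  have h1 := hconv.norm_image_sub_le_of_norm_hasDerivWithin_le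
    (f := fun r => x r b - r • V) (f' := fun r => velocity L (x r b, p r b, r) - V) (C := c)
    (x := t) (y := s)
    (fun r hr => by
      have := ((h.hasDerivWithinAt_position b hr.1).mono (inter_subset_left (t := ball t₀ δ))).sub
        (((hasDerivAt_id r).smul_const V).hasDerivWithinAt)
      simpa [Pi.sub_def] using this)
    (fun r hr => by
      rw [← dist_eq_norm]
      refine (hb (x := (r, b)) ⟨hr.1, mem_univ _⟩ ?_).le
      rw [Prod.dist_eq]
      exact max_lt hr.2 hb')
    ⟨ht, ht'⟩ ⟨hs, hs'⟩
  rw [Real.norm_eq_abs] at h1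
  have h2 : x s b - x t b - (s - t) • V = x s b - s • V - (x t b - t • V) := by
    rw [sub_smul]; abel
  rw [h2]
  exact h1

/-- If two solutions agree below a backward cone in ray coordinates and have the same
gradient at a boundary point of the cone, then they agree near that point. -/
theorem eventually_eq_of_cone (h : IsRayFamily L S₀ T x p) {S S' : ℝ → Conf N → ℝ}
    (hS : IsHJSolution (hamiltonian L) S₀ T S) (hS' : IsHJSolution (hamiltonian L) S₀ T S')
    {t₀ : ℝ} (ht₀ : t₀ ∈ Icc 0 T) {a₀ a₁ : Conf N}
    (hp : gradient (S' t₀) (x t₀ a₀) = p t₀ a₀)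
    (hg : gradient (S t₀) (x t₀ a₀) = gradient (S' t₀) (x t₀ a₀))
    (hcone : ∀ t ∈ Icc 0 T, ∀ b, t + ‖b - a₁‖ < t₀ + ‖a₀ - a₁‖ →
      S t (x t b) = S' t (x t b)) :
    ∀ᶠ q in 𝓝[Icc 0 T ×ˢ univ] (t₀, a₀), S q.1 (x q.1 q.2) = S' q.1 (x q.1 q.2) := by
  obtain ⟨C, hC, ε₀, hε₀, hLip⟩ := h.exists_phase_le_position ht₀ a₀
  -- Over a time `k`, the cone and the deviation of the ray from a straight line displace positions
  -- by at most `2 * c * k`, hence ray labels by at most `k / 2`.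
  set c := 1 / (4 * C) with hcdef
  have hc : 0 < c := by positivity
  set y₀ := x t₀ a₀ with hy₀
  set V := velocity L (x t₀ a₀, p t₀ a₀, t₀) with hV
  obtain ⟨δ₁, hδ₁, htrans⟩ := h.exists_transport_le hS hS' ht₀ hg hc
  rw [hp] at htrans
  obtain ⟨δ₂, hδ₂, hdisp⟩ := h.exists_displacement_le ht₀ a₀ hc
  obtain ⟨δ₃, hδ₃, hinv⟩ := Metric.continuousWithinAt_iff.1
    (h.continuousOn_invFun (t₀, y₀) ⟨ht₀, mem_univ _⟩) ε₀ hε₀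
  simp only [hy₀, h.invFun_position ht₀] at hinv
  obtain ⟨ρ, hρ, hρε, hρ1, hρ2, hρ3⟩ : ∃ ρ > 0, ρ ≤ ε₀ ∧ ρ ≤ δ₁ ∧ ρ ≤ δ₂ ∧ ρ ≤ δ₃ :=
    ⟨min (min ε₀ δ₁) (min δ₂ δ₃), by positivity,
      (min_le_left _ _).trans (min_le_left _ _), (min_le_left _ _).trans (min_le_right _ _),
      (min_le_right _ _).trans (min_le_left _ _), (min_le_right _ _).trans (min_le_right _ _)⟩
  -- Any cone of height at most `k` with apex position within `ρ / 2` of `y₀` then stays in the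
  -- region where all local estimates hold.
  set k := ρ / (4 * (c + ‖V‖ + 1)) with hk
  have hkpos : 0 < k := by positivity
  have hk1 : (c + ‖V‖) * k ≤ ρ / 4 := by
    rw [hk, mul_div_assoc', div_le_div_iff₀ (by positivity) (by positivity)]
    nlinarith [norm_nonneg V]
  have hk2 : k ≤ ρ / 4 := by
    rw [hk]
    apply div_le_div_of_nonneg_left hρ.le (by norm_num)
    linarith [norm_nonneg V]
  have hxc : ∀ᶠ q in 𝓝[Icc 0 T ×ˢ univ] (t₀, a₀), ‖x q.1 q.2 - y₀‖ < ρ / 2 := by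
    have := (h.continuousOn_phase.fst (t₀, a₀) ⟨ht₀, mem_univ _⟩).eventually_mem
      (ball_mem_nhds _ (half_pos hρ))
    filter_upwards [this] with q hq
    rwa [mem_ball, dist_eq_norm] at hq
  filter_upwards [hxc, self_mem_nhdsWithin, nhdsWithin_le_nhds
    (ball_mem_nhds (t₀, a₀) (ε := k / 8) (by positivity))] with q hq1 hq2 hq3
  obtain ⟨t₁, b⟩ := q
  have ht₁ : t₁ ∈ Icc 0 T := hq2.1
  simp only at hq1
  have hq3' : |t₁ - t₀| < k / 8 ∧ ‖b - a₀‖ < k / 8 := by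
    rw [mem_ball, Prod.dist_eq, max_lt_iff, Real.dist_eq, dist_eq_norm] at hq3
    exact hq3
  set y₁ := x t₁ b with hy₁
  set s₀ := max 0 (t₁ - k) with hs₀
  have hs₀t : s₀ ≤ t₁ := max_le ht₁.1 (by linarith)
  have hsub : Icc s₀ t₁ ⊆ Icc 0 T := Icc_subset_Icc (le_max_left _ _) ht₁.2
  have habs := abs_lt.1 hq3'.1
  have htime : ∀ t ∈ Icc s₀ t₁, |t - t₀| < ρ := by
    intro t ht
    have : t₁ - k ≤ t := (le_max_right _ _).trans ht.1
    rw [abs_lt]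
    constructor <;> linarith [ht.2]
  have hpt : ∀ t ∈ Icc s₀ t₁, ∀ y, ‖y - y₁ - (t - t₁) • V‖ ≤ c * (t₁ - t) →
      dist (t, y) (t₀, y₀) < ρ := by
    intro t ht y hy
    have h1 : t₁ - t ≤ k := by linarith [(le_max_right 0 (t₁ - k)).trans ht.1]
    rw [Prod.dist_eq]
    refine max_lt (htime t ht) ?_
    rw [dist_eq_norm]
    have h2 : ‖(t - t₁) • V‖ = (t₁ - t) * ‖V‖ := by
      rw [norm_smul, Real.norm_eq_abs, abs_sub_comm, abs_of_nonneg (by linarith [ht.2])]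
    have h3 : (c + ‖V‖) * (t₁ - t) ≤ (c + ‖V‖) * k :=
      mul_le_mul_of_nonneg_left h1 (by positivity)
    calc ‖y - y₀‖ = ‖(y - y₁ - (t - t₁) • V) + (t - t₁) • V + (y₁ - y₀)‖ := by congr 1; abel
      _ ≤ ‖y - y₁ - (t - t₁) • V‖ + ‖(t - t₁) • V‖ + ‖y₁ - y₀‖ := norm_add₃_le
      _ < ρ := by rw [h2]; linarith
  have key := cone_eq_zero (w := fun q => S q.1 q.2 - S' q.1 q.2)
    (τ := fun q => -hamiltonian L (q.2, gradient (S q.1) q.2, q.1) -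
      -hamiltonian L (q.2, gradient (S' q.1) q.2, q.1))
    (g := fun q => gradient (S q.1) q.2 - gradient (S' q.1) q.2) (y₁ := y₁) (V := V) hs₀t hc.le
    (fun t ht y _ => by
      have h1 := ((hS.hasFDerivWithinAt h.pos (hsub ht) y).sub
        (hS'.hasFDerivWithinAt h.pos (hsub ht) y)).mono
          (prod_mono hsub (le_refl (univ : Set (Conf N))))
      rw [spacetimeDifferential_sub] at h1
      exact h1)
    (fun t ht y hy => htrans t (hsub ht) y ((hpt t ht y hy).trans_le hρ1))
    (fun y hy => by
      -- Either the cone reaches time 0, where the initial values agree, or its base has to be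
      -- located below the critical level.
      rcases le_total (t₁ - k) 0 with hle | hle
      · have : s₀ = 0 := max_eq_left hle
        simp only [this, hS.initial, hS'.initial, sub_self]
      · have hs : s₀ = t₁ - k := max_eq_right hle
        have hs₀mem : s₀ ∈ Icc s₀ t₁ := left_mem_Icc.2 hs₀t
        have hs₀I := hsub hs₀mem
        have hb1 : b ∈ ball a₀ ρ := by
          rw [mem_ball, dist_eq_norm]; linarith [hq3'.2]
        set b' := Function.invFun (x s₀) y with hb'
        have hxb : x s₀ b' = y := h.position_invFun hs₀I y
        have hb'mem : b' ∈ ball a₀ ε₀ :=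
          hinv (x := (s₀, y)) ⟨hs₀I, mem_univ _⟩ ((hpt s₀ hs₀mem y hy).trans_le hρ3)
        have hd := hdisp s₀ hs₀I ((htime s₀ hs₀mem).trans_le hρ2) t₁ ht₁
          ((htime t₁ (right_mem_Icc.2 hs₀t)).trans_le hρ2) b (ball_subset_ball hρ2 hb1)
        rw [abs_sub_comm, abs_of_nonneg (by linarith)] at hd
        have hyb : ‖x s₀ b' - x s₀ b‖ ≤ 2 * c * k := by
          have hk' : t₁ - s₀ = k := by rw [hs]; ring
          rw [hk'] at hd hy
          calc ‖x s₀ b' - x s₀ b‖ = ‖(y - y₁ - (s₀ - t₁) • V) -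
                (x s₀ b - x t₁ b - (s₀ - t₁) • V)‖ := by rw [hxb, hy₁]; congr 1; abel
            _ ≤ c * k + c * k := (norm_sub_le _ _).trans (add_le_add hy hd)
            _ = 2 * c * k := by ring
        have hbb : ‖b' - b‖ ≤ k / 2 := by
          have h0 : (0 : ℝ) ∈ Icc 0 T := left_mem_Icc.2 h.pos.le
          have h1 := hLip s₀ hs₀I ((htime s₀ hs₀mem).trans_le hρε) b' hb'mem b
            (ball_subset_ball hρε hb1) 0 h0
          have h2 := (norm_fst_le _).trans h1
          simp only [Prod.fst_sub, h.flow.position_zero] at h2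
          refine h2.trans ?_
          calc C * ‖x s₀ b' - x s₀ b‖ ≤ C * (2 * c * k) := by gcongr
            _ = k / 2 := by rw [hcdef]; field_simp; norm_num
        -- Going back in time gains `k`; the label drift costs at most `k / 2` and the offset of the
        -- apex from `(t₀, a₀)` less than `k / 8` twice.
        have hφ : s₀ + ‖b' - a₁‖ < t₀ + ‖a₀ - a₁‖ := by
          have h1 : ‖b' - a₁‖ ≤ ‖b' - b‖ + ‖b - a₀‖ + ‖a₀ - a₁‖ := by
            calc ‖b' - a₁‖ = ‖(b' - b) + (b - a₀) + (a₀ - a₁)‖ := by congr 1; abel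
              _ ≤ _ := norm_add₃_le
          linarith [hq3'.2]
        have := hcone s₀ hs₀I b' hφ
        rw [hxb] at this
        simp only [this, sub_self])
  exact sub_eq_zero.1 key

/-- At earlier times the ray of `a₀` lies in the open region of agreement, so the gradients coincide
there; they are continuous up to `t₀`. For `t₀ = 0` both equal the initial gradient. -/
theorem gradient_eq_of_cone (h : IsRayFamily L S₀ T x p) {S S' : ℝ → Conf N → ℝ}
    (hS : IsHJSolution (hamiltonian L) S₀ T S) (hS' : IsHJSolution (hamiltonian L) S₀ T S')
    {t₀ : ℝ} (ht₀ : t₀ ∈ Icc 0 T) {a₀ a₁ : Conf N}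
    (hcone : ∀ t ∈ Icc 0 T, ∀ b, t + ‖b - a₁‖ < t₀ + ‖a₀ - a₁‖ →
      S t (x t b) = S' t (x t b)) :
    gradient (S t₀) (x t₀ a₀) = gradient (S' t₀) (x t₀ a₀) := by
  rcases ht₀.1.eq_or_lt with h0 | h0
  · subst h0
    rw [funext hS.initial, funext hS'.initial]
  have hsub : Ico 0 t₀ ⊆ Icc 0 T := fun s hs => ⟨hs.1, hs.2.le.trans ht₀.2⟩
  have heq : ∀ s ∈ Ico 0 t₀, gradient (S s) (x s a₀) = gradient (S' s) (x s a₀) := by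
    intro s hs
    have hsI := hsub hs
    have hc : Continuous fun y => s + ‖Function.invFun (x s) y - a₁‖ := by
      have := (h.diffeo s hsI).contDiff_invFun.continuous
      fun_prop
    have hev : ∀ᶠ y in 𝓝 (x s a₀), s + ‖Function.invFun (x s) y - a₁‖ < t₀ + ‖a₀ - a₁‖ := by
      refine hc.continuousAt.eventually (gt_mem_nhds ?_)
      simp only [h.invFun_position hsI]
      linarith [hs.2]
    have hSS : S s =ᶠ[𝓝 (x s a₀)] S' s := by
      filter_upwards [hev] with y hy
      have := hcone s hsI _ hy
      rwa [h.position_invFun hsI] at this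
    rw [gradient, gradient, hSS.fderiv_eq]
  have hlim : ∀ S : ℝ → Conf N → ℝ, IsHJSolution (hamiltonian L) S₀ T S →
      Tendsto (fun s => gradient (S s) (x s a₀)) (𝓝[Ico 0 t₀] t₀)
        (𝓝 (gradient (S t₀) (x t₀ a₀))) := by
    intro S hS
    have h1 : ContinuousWithinAt (fun s => (s, x s a₀)) (Icc 0 T) t₀ :=
      continuousWithinAt_id.prodMk (h.hasDerivWithinAt_position a₀ ht₀).continuousWithinAt
    have h2 : ContinuousWithinAt (fun s => gradient (S s) (x s a₀)) (Icc 0 T) t₀ :=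
      (hS.continuousOn_gradient h.pos (t₀, x t₀ a₀) ⟨ht₀, mem_univ _⟩).comp
        (f := fun s => (s, x s a₀)) h1 (fun s hs => ⟨hs, mem_univ _⟩)
    exact h2.mono hsub
  have hne : (𝓝[Ico 0 t₀] t₀).NeBot := by
    rw [nhdsWithin_Ico_eq_nhdsLT h0]; infer_instance
  refine tendsto_nhds_unique_of_eventuallyEq (hlim S hS) (hlim S' hS') ?_
  filter_upwards [self_mem_nhdsWithin] with s hs using heq s hs

theorem eq_action (h : IsRayFamily L S₀ T x p) {S : ℝ → Conf N → ℝ}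
    (hS : IsHJSolution (hamiltonian L) S₀ T S) {t : ℝ} (ht : t ∈ Icc 0 T) (y : Conf N) :
    S t y = action L S₀ T x t y := by
  by_contra hne
  set S' := action L S₀ T x with hS'def
  have hS' : IsHJSolution (hamiltonian L) S₀ T S' := h.isHJSolution_action
  set a₁ := Function.invFun (x t) y with ha₁
  have hxa : x t a₁ = y := h.position_invFun ht y
  set D : Set (ℝ × Conf N) :=
    {q | q ∈ Icc 0 T ×ˢ (univ : Set (Conf N)) ∧ S q.1 (x q.1 q.2) ≠ S' q.1 (x q.1 q.2)} with hD
  have hmemD : (t, a₁) ∈ D := ⟨⟨ht, mem_univ _⟩, by simpa only [hxa] using hne⟩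
  have hcl : closure D ⊆ Icc 0 T ×ˢ univ :=
    closure_minimal (fun q hq => hq.1) (isClosed_Icc.prod isClosed_univ)
  -- The radius `T` suffices: the value to beat, attained at `(t, a₁)`, is `t ≤ T`, and at
  -- nonnegative times a label farther than `T` from `a₁` gives a larger one.
  have hcomp : IsCompact (closure D ∩ Icc 0 T ×ˢ closedBall a₁ T) :=
    (isCompact_Icc.prod (isCompact_closedBall a₁ T)).inter_left isClosed_closure
  have hφc : Continuous fun q : ℝ × Conf N => q.1 + ‖q.2 - a₁‖ := by fun_prop
  have hmem : (t, a₁) ∈ closure D ∩ Icc 0 T ×ˢ closedBall a₁ T :=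
    ⟨subset_closure hmemD, ht, mem_closedBall_self h.pos.le⟩
  obtain ⟨⟨t₀, a₀⟩, hq, hmin⟩ := hcomp.exists_isMinOn ⟨_, hmem⟩ hφc.continuousOn
  have ht₀ : t₀ ∈ Icc 0 T := (hcl hq.1).1
  have hφ : t₀ + ‖a₀ - a₁‖ ≤ T := by
    have h1 : t₀ + ‖a₀ - a₁‖ ≤ t + ‖a₁ - a₁‖ := hmin hmem
    simp only [sub_self, norm_zero, add_zero] at h1
    exact h1.trans ht.2
  have hcone : ∀ s ∈ Icc 0 T, ∀ b, s + ‖b - a₁‖ < t₀ + ‖a₀ - a₁‖ →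
      S s (x s b) = S' s (x s b) := by
    intro s hs b hsb
    by_contra hne'
    have hsbD : (s, b) ∈ D := ⟨⟨hs, mem_univ _⟩, hne'⟩
    have hball : b ∈ closedBall a₁ T := by
      rw [mem_closedBall, dist_eq_norm]; linarith [hs.1]
    have h1 : t₀ + ‖a₀ - a₁‖ ≤ s + ‖b - a₁‖ := hmin ⟨subset_closure hsbD, hs, hball⟩
    linarith
  have hp : gradient (S' t₀) (x t₀ a₀) = p t₀ a₀ := by
    rw [hS'def, (h.hasGradientAt_action ht₀ _).gradient, h.invFun_position ht₀]
  have hev := h.eventually_eq_of_cone hS hS' ht₀ hp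
    (h.gradient_eq_of_cone hS hS' ht₀ hcone) hcone
  rw [eventually_nhdsWithin_iff] at hev
  have hfr := mem_closure_iff_frequently.1 hq.1
  obtain ⟨q, hqD, hqe⟩ := (hfr.and_eventually hev).exists
  exact hqD.2 (hqe hqD.1)

end IsRayFamily

end HamiltonJacobi

open HamiltonJacobi in
theorem mainTheorem11 {N : ℕ} (L : ExtPhase N → ℝ) (hL : ContDiff ℝ 2 L)
    (hlegendre : IsC1Diffeo (legendreMap L))
    (S₀ : Conf N → ℝ) (hS₀ : ContDiff ℝ 1 S₀)
    (T : ℝ) (hT : 0 < T)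
    (x p : ℝ → Conf N → Conf N)
    (hflow : IsHamiltonFlow (hamiltonian L) S₀ T x p)
    (hdiffeo : ∀ t ∈ Set.Icc 0 T, IsC1Diffeo (x t)) :
    IsHJSolution (hamiltonian L) S₀ T (action L S₀ T x) ∧
      ∀ S : ℝ → Conf N → ℝ, IsHJSolution (hamiltonian L) S₀ T S →
        ∀ t ∈ Set.Icc 0 T, ∀ y, S t y = action L S₀ T x t y := by
  have h : IsRayFamily L S₀ T x p := ⟨hL, hlegendre, hS₀, hT, hflow, hdiffeo⟩
  exact ⟨h.isHJSolution_action, fun S hS t ht y => h.eq_action hS ht y⟩
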